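/- Let $a,b\in\mathbb R^2$ be linearly independent, let $\Gamma=\mathbb Z a+\mathbb Z b$ be the lattice they generate, with fundamental cell $M_\Gamma=\{sa+tb : s,t\in[0,1]\}$ and dual lattice $\Gamma^*=\{\gamma^*\in\mathbb R^2 : \gamma^*\cdot\gamma\in 2\pi\mathbb Z\ \text{for all }\gamma\in\Gamma\}$, and let $\mathbb V=\mathbb R^2/\Gamma$ be the torus with its normalized Lebesgue measure. Assume $(\mathrm A_w)$: the vector potential $A_\Gamma:\mathbb R^2\to\mathbb R^2$ and the scalar potential $V_\Gamma:\mathbb R^2\to\mathbb R$ are $\Gamma$-periodic, the two components of $A_\Gamma$ are $C^1$ and bounded with bounded first derivatives, and $V_\Gamma$ is measurable with $\int_{M_\Gamma}|V_\Gamma(r)|^2\,d^2r<\infty$. For $k\in\mathbb R^2$ let $$H_{\mathrm{per}}(k)=\tfrac12\bigl[-i\nabla_\theta+k-A_\Gamma(\theta)\bigr]^2+V_\Gamma(\theta)$$ act in $L^2(\mathbb V)$, where derivatives are weak derivatives on the torus and sums, compositions and multiplication operators have their natural domains. Then: (i) For all $k\in\mathbb R^2$ the operator $H_{\mathrm{per}}(k)$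 has domain equal to the Sobolev space $H^2(\mathbb V)$, is self-adjoint on it, and is bounded below. (ii) For all $k\in\mathbb R^2$, $H_{\mathrm{per}}(k)$ has compact resolvent and its spectrum is purely discrete (every point of the spectrum is isolated in the spectrum and is an eigenvalue of finite multiplicity); its eigenvalues can be arranged in an infinite increasing sequence $E_1(k)\le E_2(k)\le E_3(k)\le\dots$ in which each is repeated according to its multiplicity, and $E_n(k)\to+\infty$ as $n\to\infty$. (iii) With the eigenvalues so arranged for each $k$, every $E_n(\cdot)$ is a continuous and $\Gamma^*$-periodic function of $k\in\mathbb R^2$. -/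

import Mathlib

/-! ### Unbounded operators on a Hilbert space -/

namespace UnboundedOperator

variable {H : Type*} [NormedAddCommGroup H] [InnerProductSpace ℂ H]

/-- The natural domain `{x ∈ dom T | T x ∈ dom S}` of the composition `S ∘ T`. -/
def compDomain (S T : H →ₗ.[ℂ] H) : Submodule ℂ H :=
  (S.domain.comap T.toFun).map T.domain.subtype

theorem mem_domain_of_mem_compDomain {S T : H →ₗ.[ℂ] H} {x : H} (hx : x ∈ compDomain S T) :
    x ∈ T.domain := by
  obtain ⟨y, -, rfl⟩ := hx
  exact y.2

theorem apply_mem_domain_of_mem_compDomain {S T : H →ₗ.[ℂ] H} {x : H} (hx : x ∈ compDomain S T) :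
    T ⟨x, mem_domain_of_mem_compDomain hx⟩ ∈ S.domain := by
  obtain ⟨y, hy, rfl⟩ := hx
  exact hy

/-- The composition `S ∘ T` of unbounded operators on its natural domain. -/
noncomputable def comp (S T : H →ₗ.[ℂ] H) : H →ₗ.[ℂ] H where
  domain := compDomain S T
  toFun :=
    { toFun := fun x => S ⟨T ⟨x, mem_domain_of_mem_compDomain x.2⟩,
        apply_mem_domain_of_mem_compDomain x.2⟩
      map_add' := fun x y => by
        rw [← S.map_add]
        congr 1
        exact Subtype.ext (T.map_add ⟨x, mem_domain_of_mem_compDomain x.2⟩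
          ⟨y, mem_domain_of_mem_compDomain y.2⟩)
      map_smul' := fun c x => by
        rw [RingHom.id_apply, ← S.map_smul]
        congr 1
        exact Subtype.ext (T.map_smul c ⟨x, mem_domain_of_mem_compDomain x.2⟩) }

/-- `T` is bounded below: `⟨x, T x⟩ ≥ c ‖x‖²` on the domain of `T`, for some real `c`. -/
def IsBoundedBelow (T : H →ₗ.[ℂ] H) : Prop :=
  ∃ c : ℝ, ∀ x : T.domain, c * ‖(x : H)‖ ^ 2 ≤ (inner ℂ (x : H) (T x)).re

/-- The bounded operator `R` is the resolvent `(T - z)⁻¹`, that is, for all `x` and `y`,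
`x ∈ dom T` and `(T - z) x = y` if and only if `x = R y`. -/
def IsResolventAt (T : H →ₗ.[ℂ] H) (z : ℂ) (R : H →L[ℂ] H) : Prop :=
  ∀ x y : H, (x, y + z • x) ∈ T.graph ↔ x = R y

/-- The resolvent set of an unbounded operator. -/
def resolventSet (T : H →ₗ.[ℂ] H) : Set ℂ := {z | ∃ R : H →L[ℂ] H, IsResolventAt T z R}

/-- The spectrum of an unbounded operator. -/
def spectrum (T : H →ₗ.[ℂ] H) : Set ℂ := (resolventSet T)ᶜ

/-- `T` has compact resolvent: its resolvent set is nonempty and `(T - z)⁻¹` is a compact operator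
for every `z` in the resolvent set. -/
def HasCompactResolvent (T : H →ₗ.[ℂ] H) : Prop :=
  (resolventSet T).Nonempty ∧
    ∀ (z : ℂ) (R : H →L[ℂ] H), IsResolventAt T z R → IsCompactOperator R

/-- The eigenspace `{x ∈ dom T | T x = z x}`. -/
def eigenspace (T : H →ₗ.[ℂ] H) (z : ℂ) : Submodule ℂ H :=
  T.graph.comap (LinearMap.id.prod (z • LinearMap.id))

/-- The spectrum of `T` is purely discrete: each of its points is an isolated point of the spectrum
and an eigenvalue of finite multiplicity. -/
def HasPurelyDiscreteSpectrum (T : H →ₗ.[ℂ] H) : Prop :=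
  ∀ z ∈ spectrum T,
    (∃ ε > 0, ∀ w ∈ spectrum T, dist w z < ε → w = z) ∧
      eigenspace T z ≠ ⊥ ∧ FiniteDimensional ℂ (eigenspace T z)

/-- The sequence `e 0 ≤ e 1 ≤ e 2 ≤ …` lists the real eigenvalues of `T` in increasing order, each
of them repeated according to its multiplicity (so a number that is not an eigenvalue does not
occur). -/
def IsEigenvalueList (T : H →ₗ.[ℂ] H) (e : ℕ → ℝ) : Prop :=
  Monotone e ∧ ∀ l : ℝ,
    Set.encard {n | e n = l} = Cardinal.toENat (Module.rank ℂ (eigenspace T (l : ℂ)))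

end UnboundedOperator

/-! ### Lattices in the plane and periodic functions -/

namespace BlochFiber

/-- The Euclidean plane. -/
abbrev Plane : Type := EuclideanSpace ℝ (Fin 2)

/-- The lattice `Γ = ℤ a + ℤ b`. -/
def lattice (a b : Plane) : Set Plane := {g | ∃ m n : ℤ, g = (m : ℝ) • a + (n : ℝ) • b}

/-- The dual lattice `Γ* = {γ* | γ* · γ ∈ 2πℤ for all γ ∈ Γ}`. -/
def dualLattice (a b : Plane) : Set Plane :=
  {g' | ∀ g ∈ lattice a b, ∃ m : ℤ, inner ℝ g' g = 2 * Real.pi * m}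

/-- The fundamental cell `M_Γ = {s a + t b | s, t ∈ [0, 1]}`. -/
def cell (a b : Plane) : Set Plane :=
  {r | ∃ s ∈ Set.Icc (0 : ℝ) 1, ∃ t ∈ Set.Icc (0 : ℝ) 1, r = s • a + t • b}

/-- `f` is `Γ`-periodic. -/
def IsPeriodic (a b : Plane) {Y : Type*} (f : Plane → Y) : Prop :=
  ∀ g ∈ lattice a b, ∀ r, f (r + g) = f r

/-- The internal potentials, weak form: `A` and `V` are `Γ`-periodic, the two components of
`A` are continuously differentiable and bounded with bounded first derivatives, and `V` is square
integrable over the fundamental cell. -/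
structure WeakAssumption (a b : Plane) (A : Plane → Plane) (V : Plane → ℝ) : Prop where
  periodic_A : IsPeriodic a b A
  periodic_V : IsPeriodic a b V
  contDiff_A : ∀ j, ContDiff ℝ 1 fun r => A r j
  bounded_A : ∀ j, ∃ C : ℝ, ∀ r, |A r j| ≤ C
  bounded_fderiv_A : ∀ j, ∃ C : ℝ, ∀ r, ‖fderiv ℝ (fun x => A x j) r‖ ≤ C
  memLp_V : MeasureTheory.MemLp V 2 (MeasureTheory.volume.restrict (cell a b))

/-! ### The torus `ℝ² / Γ` -/

/-- The normalized Lebesgue measure on the fundamental cell. This is the normalized measure of the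
torus `ℝ² / Γ`, the torus being the cell with opposite edges identified (the edges are null
sets). -/
noncomputable def torusMeasure (a b : Plane) : MeasureTheory.Measure Plane :=
  ProbabilityTheory.cond MeasureTheory.volume (cell a b)

/-- The Hilbert space `L²(ℝ² / Γ)`: a square integrable function on the torus, or equivalently a
`Γ`-periodic function, is given by its values almost everywhere on the fundamental cell. -/
abbrev TorusL2 (a b : Plane) : Type := MeasureTheory.Lp ℂ 2 (torusMeasure a b)

/-- Smooth functions on the torus `ℝ² / Γ`, that is, smooth `Γ`-periodic functions. -/
def IsTorusSmooth (a b : Plane) (f : Plane → ℂ) : Prop :=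
  ContDiff ℝ (⊤ : ℕ∞) f ∧ IsPeriodic a b f

/-- The classical partial derivative `∂_j f`. -/
noncomputable def pderiv (j : Fin 2) (f : Plane → ℂ) (x : Plane) : ℂ :=
  fderiv ℝ f x (EuclideanSpace.single j 1)

/-- `g` is the weak partial derivative `∂_j u` on the torus: `∫ u ∂_j f = - ∫ g f` for all smooth
functions `f` on the torus. -/
def IsWeakDeriv (a b : Plane) (j : Fin 2) (u g : TorusL2 a b) : Prop :=
  ∀ f : Plane → ℂ, IsTorusSmooth a b f →
    ∫ x, u x * pderiv j f x ∂torusMeasure a b = - ∫ x, g x * f x ∂torusMeasure a b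

/-- The Sobolev space `H²(ℝ² / Γ)`: all weak partial derivatives of order at most two exist in
`L²`. -/
def sobolevTwo (a b : Plane) : Set (TorusL2 a b) :=
  {u | ∀ i, ∃ g, IsWeakDeriv a b i u g ∧ ∀ j, ∃ h, IsWeakDeriv a b j g h}

/-! ### The fiber operators -/

theorem isCompact_cell (a b : Plane) : IsCompact (cell a b) := by
  have h : cell a b = (fun p : ℝ × ℝ => p.1 • a + p.2 • b) ''
      (Set.Icc (0 : ℝ) 1 ×ˢ Set.Icc (0 : ℝ) 1) := by
    ext r
    constructor
    · rintro ⟨s, hs, t, ht, rfl⟩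
      exact ⟨(s, t), ⟨hs, ht⟩, rfl⟩
    · rintro ⟨⟨s, t⟩, ⟨hs, ht⟩, rfl⟩
      exact ⟨s, hs, t, ht, rfl⟩
  rw [h]
  exact (isCompact_Icc.prod isCompact_Icc).image (by fun_prop)

theorem memLp_of_continuous (a b : Plane) {f : Plane → ℂ} (hf : Continuous f) :
    MeasureTheory.MemLp f 2 (torusMeasure a b) := by
  obtain ⟨C, hC⟩ := (isCompact_cell a b).exists_bound_of_continuousOn hf.continuousOn
  have : MeasureTheory.IsFiniteMeasure (torusMeasure a b) := by
    unfold torusMeasure; infer_instance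
  exact MeasureTheory.MemLp.of_bound hf.aestronglyMeasurable C
    (ProbabilityTheory.ae_cond_of_forall_mem (isCompact_cell a b).measurableSet hC)

theorem integrable_mul_of_continuous (a b : Plane) (u : TorusL2 a b) {f : Plane → ℂ}
    (hf : Continuous f) : MeasureTheory.Integrable (fun x => u x * f x) (torusMeasure a b) :=
  (MeasureTheory.Lp.memLp u).integrable_mul (memLp_of_continuous a b hf)

theorem IsTorusSmooth.continuous_pderiv {a b : Plane} {f : Plane → ℂ} (hf : IsTorusSmooth a b f)
    (j : Fin 2) : Continuous (pderiv j f) :=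
  (hf.1.continuous_fderiv (by simp)).clm_apply continuous_const

theorem integral_add_mul (a b : Plane) (u v : TorusL2 a b) {f : Plane → ℂ} (hf : Continuous f) :
    ∫ x, (u + v) x * f x ∂torusMeasure a b =
      ∫ x, u x * f x ∂torusMeasure a b + ∫ x, v x * f x ∂torusMeasure a b := by
  rw [← MeasureTheory.integral_add (integrable_mul_of_continuous a b u hf)
    (integrable_mul_of_continuous a b v hf)]
  refine MeasureTheory.integral_congr_ae ?_
  filter_upwards [MeasureTheory.Lp.coeFn_add u v] with x hx
  rw [hx, Pi.add_apply, add_mul]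

theorem integral_smul_mul (a b : Plane) (c : ℂ) (u : TorusL2 a b) (f : Plane → ℂ) :
    ∫ x, (c • u) x * f x ∂torusMeasure a b = c * ∫ x, u x * f x ∂torusMeasure a b := by
  rw [← MeasureTheory.integral_const_mul]
  refine MeasureTheory.integral_congr_ae ?_
  filter_upwards [MeasureTheory.Lp.coeFn_smul c u] with x hx
  rw [hx, Pi.smul_apply, smul_eq_mul, mul_assoc]

/-- The graph of the weak partial derivative `∂_j` on `L²(ℝ² / Γ)`. -/
def weakDerivGraph (a b : Plane) (j : Fin 2) : Submodule ℂ (TorusL2 a b × TorusL2 a b) where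
  carrier := {p | IsWeakDeriv a b j p.1 p.2}
  zero_mem' := fun f _ => by
    have h (f : Plane → ℂ) :
        ∫ x, (0 : TorusL2 a b) x * f x ∂torusMeasure a b = 0 := by
      simpa using integral_smul_mul a b 0 0 f
    simp only [Prod.fst_zero, Prod.snd_zero, h, neg_zero]
  add_mem' := fun {p q} hp hq f hf => by
    simp only [Prod.fst_add, Prod.snd_add]
    rw [integral_add_mul a b _ _ (hf.continuous_pderiv j),
      integral_add_mul a b _ _ hf.1.continuous, hp f hf, hq f hf, neg_add]
  smul_mem' := fun c p hp f hf => by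
    simp only [Prod.smul_fst, Prod.smul_snd]
    rw [integral_smul_mul, integral_smul_mul, hp f hf, mul_neg]

/-- The weak partial derivative `∂_j` as an unbounded operator on `L²(ℝ² / Γ)`, with domain the
functions that have a weak partial derivative in `L²`. -/
noncomputable def weakDeriv (a b : Plane) (j : Fin 2) : TorusL2 a b →ₗ.[ℂ] TorusL2 a b :=
  (weakDerivGraph a b j).toLinearPMap

/-- Coordinates with respect to the basis `a, b`. -/
noncomputable def coords (a b : Plane) (hab : LinearIndependent ℝ ![a, b]) :
    Plane ≃L[ℝ] (Fin 2 → ℝ) :=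
  (basisOfLinearIndependentOfCardEqFinrank hab (by simp)).equivFunL

theorem coords_symm_apply {a b : Plane} (hab : LinearIndependent ℝ ![a, b]) (x : Fin 2 → ℝ) :
    (coords a b hab).symm x = x 0 • a + x 1 • b := by
  change (basisOfLinearIndependentOfCardEqFinrank hab _).equivFun.symm x = _
  rw [Module.Basis.equivFun_symm_apply]
  simp

theorem coords_add_lattice {a b : Plane} (hab : LinearIndependent ℝ ![a, b]) {g : Plane}
    (hg : g ∈ lattice a b) (r : Plane) (i : Fin 2) :
    ∃ m : ℤ, coords a b hab (r + g) i = coords a b hab r i + m := by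
  obtain ⟨m, n, rfl⟩ := hg
  have h : (m : ℝ) • a + (n : ℝ) • b = (coords a b hab).symm ![(m : ℝ), (n : ℝ)] := by
    simp [coords_symm_apply]
  rw [map_add, h, ContinuousLinearEquiv.apply_symm_apply]
  fin_cases i
  · exact ⟨m, rfl⟩
  · exact ⟨n, rfl⟩

theorem torusMeasure_eq_map {a b : Plane} (hab : LinearIndependent ℝ ![a, b]) :
    torusMeasure a b = MeasureTheory.Measure.map (coords a b hab).symm
      (MeasureTheory.volume.restrict (Set.Icc (0 : Fin 2 → ℝ) 1)) := by
  set e := (coords a b hab).symm with he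
  let em : (Fin 2 → ℝ) ≃ᵐ Plane := e.toHomeomorph.toMeasurableEquiv
  have hcell : em ⁻¹' cell a b = Set.Icc (0 : Fin 2 → ℝ) 1 := by
    ext x
    constructor
    · rintro ⟨s, hs, t, ht, h⟩
      have h' : e x = e ![s, t] := by
        rw [show e x = s • a + t • b from h, he, coords_symm_apply]; simp
      obtain rfl := e.injective h'
      refine ⟨fun i => ?_, fun i => ?_⟩ <;> fin_cases i
      exacts [hs.1, ht.1, hs.2, ht.2]
    · rintro ⟨h0, h1⟩
      exact ⟨x 0, ⟨h0 0, h1 0⟩, x 1, ⟨h0 1, h1 1⟩, coords_symm_apply hab x⟩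
  have hmap : MeasureTheory.Measure.map em
      (MeasureTheory.volume.restrict (Set.Icc (0 : Fin 2 → ℝ) 1)) =
        (MeasureTheory.Measure.map em MeasureTheory.volume).restrict (cell a b) := by
    rw [MeasurableEquiv.restrict_map, hcell]
  have : (MeasureTheory.Measure.map em MeasureTheory.volume).IsAddHaarMeasure :=
    e.isAddHaarMeasure_map MeasureTheory.volume
  obtain ⟨c, hc⟩ : ∃ c : NNReal, MeasureTheory.Measure.map em MeasureTheory.volume =
      c • (MeasureTheory.volume : MeasureTheory.Measure Plane) :=
    ⟨_, MeasureTheory.Measure.isAddLeftInvariant_eq_smul _ _⟩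
  change _ = MeasureTheory.Measure.map em _
  rw [hmap, hc, MeasureTheory.Measure.restrict_smul, torusMeasure, ProbabilityTheory.cond]
  have hone : (c : ENNReal) * MeasureTheory.volume (cell a b) = 1 := by
    have h1 : MeasureTheory.Measure.map em MeasureTheory.volume (cell a b) = 1 := by
      rw [em.map_apply, hcell, Real.volume_Icc_pi]; simp
    rw [hc] at h1
    exact h1
  rw [← ENNReal.eq_inv_of_mul_eq_one_left hone]
  rfl

/-- Only the zero function is orthogonal to all smooth functions on the torus. -/
theorem eq_zero_of_integral_mul_eq_zero {a b : Plane} (hab : LinearIndependent ℝ ![a, b])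
    (g : TorusL2 a b)
    (hg : ∀ f, IsTorusSmooth a b f → ∫ x, g x * f x ∂torusMeasure a b = 0) : g = 0 := by
  let _ : MeasureTheory.MeasureSpace UnitAddCircle := ⟨AddCircle.haarAddCircle⟩
  set e := (coords a b hab).symm with he
  let em : (Fin 2 → ℝ) ≃ᵐ Plane := e.toHomeomorph.toMeasurableEquiv
  let I : Set (Fin 2 → ℝ) := {x | ∀ i, x i ∈ Set.Ioc ((0 : Fin 2 → ℝ) i) ((0 : Fin 2 → ℝ) i + 1)}
  have hI : MeasurableSet I := MeasurableSet.univ_pi' fun i => measurableSet_Ioc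
  have hIcc : I =ᵐ[MeasureTheory.volume] Set.Icc (0 : Fin 2 → ℝ) 1 := by
    have h : I = Set.univ.pi fun i => Set.Ioc ((0 : Fin 2 → ℝ) i) ((1 : Fin 2 → ℝ) i) := by
      ext x
      simp [I]
    rw [h]
    exact MeasureTheory.Measure.univ_pi_Ioc_ae_eq_Icc (μ := fun _ : Fin 2 =>
      (MeasureTheory.volume : MeasureTheory.Measure ℝ))
  have hμ : torusMeasure a b = MeasureTheory.Measure.map em (MeasureTheory.volume.restrict I) := by
    rw [torusMeasure_eq_map hab, MeasureTheory.Measure.restrict_congr_set hIcc]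
    rfl
  have hp : MeasureTheory.MeasurePreserving em (MeasureTheory.volume.restrict I)
      (torusMeasure a b) := ⟨em.measurable, hμ.symm⟩
  let q := UnitAddTorus.measurableEquivPiIoc (0 : Fin 2 → ℝ)
  have hq : MeasureTheory.MeasurePreserving (fun t => (q t : Fin 2 → ℝ)) MeasureTheory.volume
      (MeasureTheory.volume.restrict I) := by
    have h1 := UnitAddTorus.measurePreserving_equivPiIoc (0 : Fin 2 → ℝ)
    have h2 : MeasureTheory.MeasurePreserving (Subtype.val : I → Fin 2 → ℝ)
        (MeasureTheory.Measure.comap Subtype.val MeasureTheory.volume)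
        (MeasureTheory.volume.restrict I) :=
      ⟨measurable_subtype_coe, map_comap_subtype_coe hI _⟩
    exact h2.comp h1
  have hpq := hp.comp hq
  set P : UnitAddTorus (Fin 2) → Plane := em ∘ fun t => (q t : Fin 2 → ℝ) with hP
  have hG : MeasureTheory.MemLp (g ∘ P) 2 MeasureTheory.volume :=
    (MeasureTheory.Lp.memLp g).comp_measurePreserving hpq
  have hzero : hG.toLp (g ∘ P) = 0 := by
    rw [← UnitAddTorus.mFourierBasis.repr.map_eq_zero_iff]
    ext n
    rw [UnitAddTorus.mFourierBasis_repr]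
    let f : Plane → ℂ := fun y => UnitAddTorus.mFourier (-n)
      (fun i => ((coords a b hab y i : ℝ) : UnitAddCircle))
    have hf : IsTorusSmooth a b f := by
      constructor
      · have : f = fun y => ∏ i, Complex.exp (2 * Real.pi * Complex.I * ((-n) i : ℤ) *
            ((coords a b hab y i : ℝ) : ℂ) / (1 : ℝ)) := by
          ext y
          simp only [f, UnitAddTorus.mFourier, ContinuousMap.coe_mk, fourier_coe_apply]
        rw [this]
        refine contDiff_prod fun i _ => ContDiff.cexp ?_
        have : ContDiff ℝ (⊤ : ℕ∞) fun y => coords a b hab y i :=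
          (contDiff_apply ℝ ℝ i).comp (coords a b hab).contDiff
        have h2 : ContDiff ℝ (⊤ : ℕ∞) fun y => ((coords a b hab y i : ℝ) : ℂ) :=
          Complex.ofRealCLM.contDiff.comp this
        exact (contDiff_const.mul h2).div_const _
      · intro l hl r
        simp only [f]
        congr 1
        ext i
        obtain ⟨m, hm⟩ := coords_add_lattice hab hl r i
        rw [hm, AddCircle.coe_add]
        simp
    have key : ∫ t, (fun x => f x * g x) (P t) = ∫ x, f x * g x ∂torusMeasure a b := by
      have h (F : Plane → ℂ) (hF : MeasureTheory.AEStronglyMeasurable F (torusMeasure a b)) :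
          ∫ t, F (P t) = ∫ x, F x ∂torusMeasure a b := by
        rw [← hpq.map_eq] at hF ⊢
        exact (MeasureTheory.integral_map hpq.measurable.aemeasurable hF).symm
      refine h (fun x => f x * g x) ?_
      exact hf.1.continuous.aestronglyMeasurable.mul (MeasureTheory.Lp.aestronglyMeasurable g)
    have h0 : ∫ x, f x * g x ∂torusMeasure a b = 0 := by
      simpa only [mul_comm] using hg f hf
    rw [UnitAddTorus.mFourierCoeff]
    refine Eq.trans (MeasureTheory.integral_congr_ae ?_) (key.trans h0)
    filter_upwards [hG.coeFn_toLp] with t ht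
    rw [ht]
    have : (fun i => ((coords a b hab (P t) i : ℝ) : UnitAddCircle)) = t := by
      have h1 : coords a b hab (P t) = (q t : Fin 2 → ℝ) :=
        (coords a b hab).apply_symm_apply _
      rw [h1]
      exact q.symm_apply_apply t
    simp only [f, this, Function.comp_apply, smul_eq_mul]
  have hae : g ∘ P =ᵐ[MeasureTheory.volume] 0 :=
    hG.coeFn_toLp.symm.trans (hzero ▸ MeasureTheory.Lp.coeFn_zero ℂ 2 _)
  have hset : MeasurableSet {x | g x = 0} :=
    (MeasureTheory.Lp.stronglyMeasurable g).measurable (measurableSet_singleton 0)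
  refine (MeasureTheory.Lp.eq_zero_iff_ae_eq_zero).2 ?_
  have hmap : ∀ᵐ x ∂MeasureTheory.Measure.map P MeasureTheory.volume, g x = 0 :=
    (MeasureTheory.ae_map_iff hpq.measurable.aemeasurable hset).2 hae
  rw [hpq.map_eq] at hmap
  exact hmap

/-- Weak derivatives are unique: the graph of `weakDeriv` is the relation that defines it. -/
theorem weakDeriv_graph {a b : Plane} (hab : LinearIndependent ℝ ![a, b]) (j : Fin 2) :
    (weakDeriv a b j).graph = weakDerivGraph a b j := by
  refine Submodule.toLinearPMap_graph_eq _ ?_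
  rintro ⟨u, g⟩ h hu
  obtain rfl : u = 0 := hu
  refine eq_zero_of_integral_mul_eq_zero hab g fun f hf => ?_
  have h0 := integral_smul_mul a b 0 (0 : TorusL2 a b) (pderiv j f)
  rw [zero_smul, zero_mul] at h0
  exact neg_eq_zero.mp ((h f hf).symm.trans h0)

/-- Multiplication by the real function `f` as an unbounded operator on `L²(ℝ² / Γ)`, with its
natural domain `{u | f u ∈ L²}`. -/
noncomputable def mulOp (a b : Plane) (f : Plane → ℝ) : TorusL2 a b →ₗ.[ℂ] TorusL2 a b where
  domain :=
    { carrier := {u | MeasureTheory.MemLp (fun x => (f x : ℂ) * u x) 2 (torusMeasure a b)}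
      zero_mem' := by
        refine MeasureTheory.MemLp.ae_eq ?_ MeasureTheory.MemLp.zero
        filter_upwards [MeasureTheory.Lp.coeFn_zero ℂ 2 (torusMeasure a b)] with x hx
        simp only [hx, Pi.zero_apply, mul_zero]
      add_mem' := fun {u v} hu hv => by
        refine MeasureTheory.MemLp.ae_eq ?_ (hu.add hv)
        filter_upwards [MeasureTheory.Lp.coeFn_add u v] with x hx
        simp only [hx, Pi.add_apply, mul_add]
      smul_mem' := fun c u hu => by
        refine MeasureTheory.MemLp.ae_eq ?_ (hu.const_smul c)
        filter_upwards [MeasureTheory.Lp.coeFn_smul c u] with x hx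
        simp only [hx, Pi.smul_apply, smul_eq_mul, mul_left_comm] }
  toFun :=
    { toFun := fun u => MeasureTheory.MemLp.toLp (fun x => (f x : ℂ) * u.1 x) u.2
      map_add' := fun u v => by
        rw [← MeasureTheory.MemLp.toLp_add, MeasureTheory.MemLp.toLp_eq_toLp_iff]
        filter_upwards [MeasureTheory.Lp.coeFn_add u.1 v.1] with x hx
        change (f x : ℂ) * (u.1 + v.1 : TorusL2 a b) x = f x * u.1 x + f x * v.1 x
        rw [hx, Pi.add_apply, mul_add]
      map_smul' := fun c u => by
        rw [RingHom.id_apply, ← MeasureTheory.MemLp.toLp_const_smul,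
          MeasureTheory.MemLp.toLp_eq_toLp_iff]
        filter_upwards [MeasureTheory.Lp.coeFn_smul c u.1] with x hx
        change (f x : ℂ) * (c • u.1 : TorusL2 a b) x = c * (f x * u.1 x)
        rw [hx, Pi.smul_apply, smul_eq_mul, mul_left_comm] }

/-- The component `-i ∂_j + k_j - A_j` of the kinetic momentum. -/
noncomputable def kineticMomentum (a b : Plane) (A : Plane → Plane) (k : Plane) (j : Fin 2) :
    TorusL2 a b →ₗ.[ℂ] TorusL2 a b :=
  (-Complex.I) • weakDeriv a b j + mulOp a b (fun x => k j - A x j)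

/-- The fiber operator `H_per(k) = ½ (-i ∇ + k - A)² + V` with its natural domain. -/
noncomputable def fiberHamiltonian (a b : Plane) (A : Plane → Plane) (V : Plane → ℝ) (k : Plane) :
    TorusL2 a b →ₗ.[ℂ] TorusL2 a b :=
  (1 / 2 : ℂ) •
      (UnboundedOperator.comp (kineticMomentum a b A k 0) (kineticMomentum a b A k 0) +
        UnboundedOperator.comp (kineticMomentum a b A k 1) (kineticMomentum a b A k 1)) +
    mulOp a b V

end BlochFiber

/-!
The exponentials `exp (i ξ · x)`, `ξ ∈ Γ*`, form an orthonormal basis of `L²(𝕍)` that diagonalises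
`-Δ/2`. In dimension two `∑ (|ξ|² / 2 + l)⁻²` is finite and tends to `0` as `l → ∞`, so the free
resolvent `(-Δ/2 + l)⁻¹` maps `L²` into bounded functions with small norm, and the potentials only
contribute a small error: `(H(k) + l) (-Δ/2 + l)⁻¹ = 1 + K_l` with `K_l → 0`. A Neumann series then
inverts `H(k) + l` on the range `H²` of the free resolvent, and the inverse is compact. For a
symmetric operator a resolvent at a real point gives self-adjointness, and compactness gives an
eigenbasis. Since `H(k + g) - H(k)` is small relative to `H(k)` as `g → 0`, the min-max principle
makes the ordered eigenvalues continuous; conjugation by `exp (i g · x)` turns `H(k)` into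
`H(k + g)` for `g ∈ Γ*`, which makes them periodic.
-/

namespace UnboundedOperator

open Filter Topology

/-! ### Symmetric operators and resolvents -/

section Symmetric

variable {H : Type*} [NormedAddCommGroup H] [InnerProductSpace ℂ H] {S T : H →ₗ.[ℂ] H}

theorem mem_graph_add {x y : H} :
    (x, y) ∈ (S + T).graph ↔ ∃ u v, (x, u) ∈ S.graph ∧ (x, v) ∈ T.graph ∧ u + v = y := by
  constructor
  · intro h
    obtain ⟨z, rfl, rfl⟩ := (LinearPMap.mem_graph_iff _).1 h
    exact ⟨S ⟨z, z.2.1⟩, T ⟨z, z.2.2⟩, S.mem_graph ⟨z, z.2.1⟩, T.mem_graph ⟨z, z.2.2⟩, rfl⟩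
  · rintro ⟨u, v, hu, hv, rfl⟩
    obtain ⟨⟨z, hz⟩, h, rfl⟩ := (LinearPMap.mem_graph_iff _).1 hu
    obtain rfl : z = x := h
    obtain ⟨⟨w, hw⟩, h, rfl⟩ := (LinearPMap.mem_graph_iff _).1 hv
    obtain rfl : w = z := h
    exact (S + T).mem_graph ⟨w, hz, hw⟩

theorem mem_graph_smul {c : ℂ} {x y : H} :
    (x, y) ∈ (c • T).graph ↔ ∃ u, (x, u) ∈ T.graph ∧ c • u = y := by
  rw [LinearPMap.smul_graph]
  constructor
  · rintro ⟨⟨u, v⟩, h, h'⟩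
    obtain ⟨rfl, rfl⟩ := Prod.mk.inj h'
    exact ⟨v, h, rfl⟩
  · rintro ⟨u, h, rfl⟩
    exact ⟨(x, u), h, rfl⟩

theorem mem_graph_comp {x z : H} :
    (x, z) ∈ (comp S T).graph ↔ ∃ y, (x, y) ∈ T.graph ∧ (y, z) ∈ S.graph := by
  constructor
  · intro h
    obtain ⟨w, rfl, rfl⟩ := (LinearPMap.mem_graph_iff _).1 h
    exact ⟨_, T.mem_graph ⟨w, mem_domain_of_mem_compDomain w.2⟩,
      S.mem_graph ⟨_, apply_mem_domain_of_mem_compDomain w.2⟩⟩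
  · rintro ⟨y, h, h'⟩
    obtain ⟨w, rfl, rfl⟩ := (LinearPMap.mem_graph_iff _).1 h
    obtain ⟨v, hv, rfl⟩ := (LinearPMap.mem_graph_iff _).1 h'
    have hw : T w ∈ S.domain := (show (v : H) = T w from hv) ▸ v.2
    obtain rfl : v = ⟨T w, hw⟩ := Subtype.ext hv
    exact (comp S T).mem_graph ⟨w, w, hw, rfl⟩

theorem mem_eigenspace {z : ℂ} {x : H} : x ∈ eigenspace T z ↔ (x, z • x) ∈ T.graph := Iff.rfl

/-- The operator `T` is symmetric: `⟪T x, y⟫ = ⟪x, T y⟫` on its domain, which need not be dense. -/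
def IsSymmetric (T : H →ₗ.[ℂ] H) : Prop :=
  ∀ x x' y y', (x, x') ∈ T.graph → (y, y') ∈ T.graph → inner ℂ x' y = inner ℂ x y'

theorem IsSymmetric.add (hS : IsSymmetric S) (hT : IsSymmetric T) : IsSymmetric (S + T) := by
  intro x x' y y' hx hy
  obtain ⟨u, v, hu, hv, rfl⟩ := mem_graph_add.1 hx
  obtain ⟨u', v', hu', hv', rfl⟩ := mem_graph_add.1 hy
  rw [inner_add_left, inner_add_right, hS _ _ _ _ hu hu', hT _ _ _ _ hv hv']

theorem IsSymmetric.smul (hT : IsSymmetric T) {c : ℂ} (hc : starRingEnd ℂ c = c) :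
    IsSymmetric (c • T) := by
  intro x x' y y' hx hy
  obtain ⟨u, hu, rfl⟩ := mem_graph_smul.1 hx
  obtain ⟨u', hu', rfl⟩ := mem_graph_smul.1 hy
  rw [inner_smul_left, inner_smul_right, hc, hT _ _ _ _ hu hu']

theorem IsSymmetric.comp_self (hT : IsSymmetric T) : IsSymmetric (comp T T) := by
  intro x x' y y' hx hy
  obtain ⟨u, hu, hu'⟩ := mem_graph_comp.1 hx
  obtain ⟨v, hv, hv'⟩ := mem_graph_comp.1 hy
  rw [hT _ _ _ _ hu' hv, hT _ _ _ _ hu hv']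

theorem IsSymmetric.isFormalAdjoint (hT : IsSymmetric T) : T.IsFormalAdjoint T :=
  fun x y => hT _ _ _ _ (T.mem_graph x) (T.mem_graph y)

section Resolvent

variable {z w : ℂ} {c : ℝ} {R R' : H →L[ℂ] H}

theorem IsResolventAt.apply_mem (h : IsResolventAt T z R) (y : H) :
    (R y, y + z • R y) ∈ T.graph :=
  (h _ _).2 rfl

theorem IsResolventAt.injective (h : IsResolventAt T z R) : Function.Injective R := by
  rw [injective_iff_map_eq_zero]
  intro y hy
  have := h.apply_mem y
  rw [hy, smul_zero, add_zero] at this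
  exact T.graph_fst_eq_zero_snd this rfl

theorem IsResolventAt.apply_eq (h : IsResolventAt T z R) {x x' : H} (hx : (x, x') ∈ T.graph) :
    R (x' - z • x) = x :=
  ((h _ _).1 (by simpa using hx)).symm

theorem IsResolventAt.mem_eigenspace_of_apply_eq_smul (h : IsResolventAt T z R) {μ : ℂ}
    (hμ : μ ≠ 0) {v : H} (hv : R v = μ • v) : v ∈ eigenspace T (z + μ⁻¹) := by
  have hmem := T.graph.smul_mem μ⁻¹ (h.apply_mem v)
  rw [hv, Prod.smul_mk, smul_add, smul_comm μ⁻¹ z, inv_smul_smul₀ hμ, ← add_smul] at hmem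
  rwa [mem_eigenspace, add_comm]

theorem IsResolventAt.isSymmetric (h : IsResolventAt T c R) (hT : IsSymmetric T) :
    (R : H →ₗ[ℂ] H).IsSymmetric := by
  intro y y'
  have := hT _ _ _ _ (h.apply_mem y) (h.apply_mem y')
  rw [inner_add_left, inner_add_right, inner_smul_left, inner_smul_right,
    Complex.conj_ofReal] at this
  exact (add_right_cancel this).symm

theorem IsResolventAt.dense_domain [CompleteSpace H] (h : IsResolventAt T c R)
    (hT : IsSymmetric T) : Dense (T.domain : Set H) := by
  rw [Submodule.dense_iff_topologicalClosure_eq_top, Submodule.topologicalClosure_eq_top_iff,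
    Submodule.eq_bot_iff]
  intro y hy
  apply h.injective
  have horth : inner ℂ (R (R y)) y = 0 :=
    (Submodule.mem_orthogonal _ _).1 hy _ (LinearPMap.mem_domain_of_mem_graph (h.apply_mem _))
  rw [map_zero, ← inner_self_eq_zero (𝕜 := ℂ), ← horth]
  exact (h.isSymmetric hT (R y) y).symm

/-- If `w = T* y` then `y = R (w - c y)`, because `R` is symmetric, and so `y ∈ dom T`. -/
theorem IsResolventAt.isSelfAdjoint [CompleteSpace H] (h : IsResolventAt T c R)
    (hT : IsSymmetric T) : IsSelfAdjoint T := by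
  have hd := h.dense_domain hT
  have hle : T ≤ T.adjoint := LinearPMap.IsFormalAdjoint.le_adjoint hd hT.isFormalAdjoint
  rw [LinearPMap.isSelfAdjoint_def]
  refine (LinearPMap.eq_of_le_of_domain_eq hle (hle.1.antisymm fun y hy => ?_)).symm
  set w := T.adjoint ⟨y, hy⟩
  have hadj {x x' : H} (hx : (x, x') ∈ T.graph) : inner ℂ w x = inner ℂ y x' := by
    obtain ⟨z, rfl, rfl⟩ := (LinearPMap.mem_graph_iff _).1 hx
    exact LinearPMap.adjoint_isFormalAdjoint hd ⟨y, hy⟩ z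
  have hy' : R (w - (c : ℂ) • y) = y := by
    refine ext_inner_right ℂ fun v => ?_
    calc inner ℂ (R (w - (c : ℂ) • y)) v
        = inner ℂ (w - (c : ℂ) • y) (R v) := h.isSymmetric hT _ v
      _ = inner ℂ y v := by
        rw [inner_sub_left, hadj (h.apply_mem v), inner_add_right, inner_smul_left,
          inner_smul_right, Complex.conj_ofReal]
        ring
  rw [← hy']
  exact LinearPMap.mem_domain_of_mem_graph (h.apply_mem _)

theorem IsResolventAt.eq_add (h : IsResolventAt T z R) (h' : IsResolventAt T w R') :
    R' = R + (w - z) • R.comp R' := by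
  ext y
  have := h.apply_eq (h'.apply_mem y)
  rw [add_sub_assoc, ← sub_smul, map_add, map_smul] at this
  simpa using this.symm

theorem IsResolventAt.hasCompactResolvent (h : IsResolventAt T z R) (hR : IsCompactOperator R) :
    HasCompactResolvent T := by
  refine ⟨⟨z, R, h⟩, fun w S hS => ?_⟩
  rw [h.eq_add hS]
  exact hR.add ((hR.comp_clm S).smul (w - z))

theorem IsResolventAt.eigenspace_eq_bot (h : IsResolventAt T z R) : eigenspace T z = ⊥ :=
  (Submodule.eq_bot_iff _).2 fun x hx => by
    simpa only [sub_self, map_zero] using (h.apply_eq (mem_eigenspace.1 hx)).symm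

/-- If `(T - z) R = B` with `B` invertible, then `(T - z)⁻¹ = R B⁻¹`. -/
theorem isResolventAt_comp_inv {B : (H →L[ℂ] H)ˣ} (hdom : ∀ x ∈ T.domain, ∃ f, R f = x)
    (h : ∀ f, (R f, (B : H →L[ℂ] H) f + z • R f) ∈ T.graph) :
    IsResolventAt T z (R ∘L ↑B⁻¹) := by
  have hBinv (f : H) : (↑B⁻¹ : H →L[ℂ] H) ((B : H →L[ℂ] H) f) = f :=
    DFunLike.congr_fun B.inv_mul f
  have hBB (f : H) : (B : H →L[ℂ] H) ((↑B⁻¹ : H →L[ℂ] H) f) = f :=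
    DFunLike.congr_fun B.mul_inv f
  intro x y
  constructor
  · intro hxy
    obtain ⟨f, rfl⟩ := hdom x (LinearPMap.mem_domain_of_mem_graph hxy)
    obtain rfl : (B : H →L[ℂ] H) f = y :=
      add_right_cancel (T.mem_graph_snd_inj (h f) hxy rfl)
    rw [ContinuousLinearMap.comp_apply, hBinv]
  · rintro rfl
    simpa only [ContinuousLinearMap.comp_apply, hBB] using h ((↑B⁻¹ : H →L[ℂ] H) y)

theorem exists_isResolventAt_of_norm_lt_one [CompleteSpace H] {K : H →L[ℂ] H}
    (hR : IsCompactOperator R) (hK : ‖K‖ < 1) (hdom : ∀ x ∈ T.domain, ∃ f, R f = x)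
    (h : ∀ f, (R f, f + K f + z • R f) ∈ T.graph) :
    ∃ R', IsResolventAt T z R' ∧ IsCompactOperator R' := by
  refine ⟨R ∘L ↑(Units.oneSub (-K) (by rwa [norm_neg]))⁻¹,
    isResolventAt_comp_inv hdom fun f => ?_, hR.comp_clm _⟩
  simpa using h f

/-- The Fredholm alternative for `R`: if `w` is not an eigenvalue of `T`, then
`(T - w) R = 1 - (w - z) R` is invertible. -/
theorem IsResolventAt.eigenspace_ne_bot [CompleteSpace H] (h : IsResolventAt T z R)
    (hR : IsCompactOperator R) (hw : w ∈ spectrum T) : eigenspace T w ≠ ⊥ := by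
  have hwz : w - z ≠ 0 := fun h0 => hw (sub_eq_zero.1 h0 ▸ ⟨R, h⟩)
  intro hbot
  rcases hR.hasEigenvalue_or_mem_resolventSet (inv_ne_zero hwz) with hev | hres
  · obtain ⟨v, hv, hv0⟩ := hev.exists_hasEigenvector
    have hmem := h.mem_eigenspace_of_apply_eq_smul (inv_ne_zero hwz)
      (Module.End.mem_eigenspace_iff.1 hv)
    rw [inv_inv, add_sub_cancel, hbot] at hmem
    exact hv0 ((Submodule.mem_bot ℂ).1 hmem)
  · obtain ⟨B, hB⟩ := (spectrum.mem_resolventSet_iff.1 hres).smul (Units.mk0 _ hwz)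
    refine hw ⟨_, isResolventAt_comp_inv (B := B) (R := R)
      (fun x hx => ⟨_, h.apply_eq (T.mem_graph ⟨x, hx⟩)⟩) fun f => ?_⟩
    have hBf : (B : H →L[ℂ] H) f = f - (w - z) • R f := by
      simp [hB, Units.smul_def, Algebra.algebraMap_eq_smul_one, smul_sub, smul_inv_smul₀ hwz]
    convert h.apply_mem f using 2
    rw [hBf, sub_smul]
    abel

end Resolvent

end Symmetric

/-! ### Eigenbases -/

section Eigenbasis

theorem nonempty_orderIso_nat {ι : Type*} [LinearOrder ι] [Infinite ι]
    (h : ∀ i : ι, (Set.Iic i).Finite) : Nonempty (ℕ ≃o ι) := by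
  obtain ⟨i₀⟩ : Nonempty ι := inferInstance
  obtain ⟨b, hb, hmin⟩ := (Set.Iic i₀).exists_min_image id (h i₀) ⟨i₀, Set.self_mem_Iic⟩
  let _ : OrderBot ι :=
    { bot := b
      bot_le := fun i => (le_total i i₀).elim (hmin i) fun hi => hb.trans hi }
  let _ : LocallyFiniteOrder ι := LocallyFiniteOrder.ofFiniteIcc fun i j =>
    (h j).subset Set.Icc_subset_Iic_self
  have : NoMaxOrder ι := ⟨fun i => by
    by_contra! hi
    exact Set.infinite_univ ((h i).subset fun j _ => hi j)⟩
  let _ : SuccOrder ι := LinearLocallyFiniteOrder.succOrder ι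
  let _ : PredOrder ι := LinearLocallyFiniteOrder.predOrder ι
  exact ⟨(orderIsoNatOfLinearSuccPredArch (ι := ι)).symm⟩

theorem exists_equiv_nat_monotone_comp {ι : Type*} [Infinite ι] {E : ι → ℝ}
    (hE : Tendsto E cofinite atTop) : ∃ σ : ℕ ≃ ι, Monotone (E ∘ σ) := by
  have hfin (L : ℝ) : {i | E i ≤ L}.Finite := by
    simpa using eventually_cofinite.1 (hE.eventually_gt_atTop L)
  -- order `ι` by `E`, breaking ties by some well-order
  obtain ⟨ord, hord⟩ : ∃ _ : LinearOrder ι, Monotone E := by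
    let _ : LinearOrder ι := WellOrderingRel.isWellOrder.linearOrder
    have hinj : Function.Injective fun i => toLex (E i, i) := fun i j h =>
      congrArg (fun p => (ofLex p).2) h
    exact ⟨LinearOrder.lift' _ hinj, fun i j hij => Prod.Lex.monotone_fst _ _ hij⟩
  obtain ⟨σ⟩ := nonempty_orderIso_nat fun i => (hfin (E i)).subset fun j hj => hord hj
  exact ⟨σ.toEquiv, hord.comp σ.monotone⟩

theorem le_of_encard_eq_of_forall_lt_eq {e e' : ℕ → ℝ} (he' : Monotone e')
    (hfin : ∀ l, {n | e n = l}.Finite) (h : ∀ l, {n | e n = l}.encard = {n | e' n = l}.encard)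
    {n : ℕ} (hlt : ∀ m < n, e m = e' m) : e' n ≤ e n := by
  by_contra! hn
  have hss : {m | e' m = e n} ⊂ {m | e m = e n} := by
    refine ⟨fun m (hm : e' m = e n) => ?_, fun hsub => hn.ne' (hsub rfl)⟩
    have hmn : m < n := lt_of_not_ge fun hle => (hn.trans_le (he' hle)).ne' hm
    exact (hlt m hmn).trans hm
  exact (((hfin _).subset hss.1).encard_lt_encard hss).ne (h _).symm

theorem eq_of_encard_eq {e e' : ℕ → ℝ} (he : Monotone e) (he' : Monotone e')
    (hfin : ∀ l, {n | e n = l}.Finite) (h : ∀ l, {n | e n = l}.encard = {n | e' n = l}.encard) :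
    e = e' := by
  have hfin' (l : ℝ) : {n | e' n = l}.Finite := by
    rw [← Set.encard_ne_top_iff, ← h]
    exact Set.encard_ne_top_iff.2 (hfin l)
  funext n
  induction n using Nat.strong_induction_on with
  | _ n ih =>
    exact le_antisymm
      (le_of_encard_eq_of_forall_lt_eq he hfin' (fun l => (h l).symm) fun m hm => (ih m hm).symm)
      (le_of_encard_eq_of_forall_lt_eq he' hfin h ih)

variable {H : Type*} [NormedAddCommGroup H] [InnerProductSpace ℂ H]

theorem exists_hilbertBasis_eigenvectors [CompleteSpace H] {R : H →L[ℂ] H}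
    (hR : IsCompactOperator R) (hs : (R : H →ₗ[ℂ] H).IsSymmetric) (hinj : Function.Injective R) :
    ∃ (ι : Type) (b : HilbertBasis ι ℂ H) (m : ι → ℝ),
      ∀ i, m i ≠ 0 ∧ R (b i) = (m i : ℂ) • b i := by
  let V (μ : ℂ) := Module.End.eigenspace (R : H →ₗ[ℂ] H) μ
  have hfin (μ : ℂ) : FiniteDimensional ℂ (V μ) := by
    rcases eq_or_ne μ 0 with rfl | hμ
    · have : V 0 = ⊥ := (Module.End.eigenspace_zero _).trans (LinearMap.ker_eq_bot.2 hinj)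
      rw [this]
      infer_instance
    · exact R.finite_dimensional_eigenspace hR μ hμ
  let v (i : Σ μ : ℂ, Fin (Module.finrank ℂ (V μ))) : H := stdOrthonormalBasis ℂ (V i.1) i.2
  have hv : Orthonormal ℂ v := hs.orthogonalFamily_eigenspaces.orthonormal_sigma_orthonormal
    fun μ => (stdOrthonormalBasis ℂ (V μ)).orthonormal
  have hev (i) : R (v i) = i.1 • v i :=
    Module.End.mem_eigenspace_iff.1 (stdOrthonormalBasis ℂ (V i.1) i.2).2
  have hspan : (Submodule.span ℂ (Set.range v))ᗮ = ⊥ := by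
    rw [eq_bot_iff, ← R.orthogonalComplement_iSup_eigenspaces_eq_bot hR hs]
    refine Submodule.orthogonal_le (iSup_le fun μ x hx => ?_)
    rw [← show _ = x from congrArg Subtype.val ((stdOrthonormalBasis ℂ (V μ)).sum_repr ⟨x, hx⟩),
      Submodule.coe_sum]
    exact Submodule.sum_mem _ fun j _ =>
      Submodule.smul_mem _ _ (Submodule.subset_span ⟨⟨μ, j⟩, rfl⟩)
  refine ⟨_, HilbertBasis.mkOfOrthogonalEqBot hv hspan, fun i => i.1.re, fun i => ?_⟩
  rw [HilbertBasis.coe_mkOfOrthogonalEqBot]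
  have hre : ((i.1.re : ℝ) : ℂ) = i.1 := Complex.conj_eq_iff_re.1 (hs.conj_eigenvalue_eq_self
    (Module.End.hasEigenvalue_of_hasEigenvector
      ⟨Module.End.mem_eigenspace_iff.2 (hev i), hv.ne_zero i⟩))
  refine ⟨fun h0 => hv.ne_zero i (hinj ?_), by rw [hre]; exact hev i⟩
  rw [hev i, ← hre, show i.1.re = 0 from h0, map_zero, Complex.ofReal_zero, zero_smul]

/-- Otherwise the images of infinitely many of the `v i` would be uniformly separated. -/
theorem tendsto_eigenvalue_cofinite {R : H →L[ℂ] H} (hR : IsCompactOperator R) {ι : Type*}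
    {v : ι → H} (hv : Orthonormal ℂ v) {m : ι → ℝ} (hm : ∀ i, R (v i) = (m i : ℂ) • v i) :
    Tendsto m cofinite (𝓝 0) := by
  have hsep {i j : ι} (hij : i ≠ j) : |m i| ≤ dist (R (v i)) (R (v j)) := by
    have hinner : inner ℂ (v i) (R (v i) - R (v j)) = (m i : ℂ) := by
      rw [hm, hm, inner_sub_right, inner_smul_right, inner_smul_right, hv.2 hij,
        inner_self_eq_norm_sq_to_K, hv.1]
      simp
    have hle := norm_inner_le_norm (𝕜 := ℂ) (v i) (R (v i) - R (v j))
    rwa [hinner, hv.1, one_mul, Complex.norm_real, ← dist_eq_norm] at hle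
  refine Metric.tendsto_nhds.2 fun ε hε => eventually_cofinite.2 ?_
  by_contra hinf
  obtain ⟨K, hK, hRK⟩ := hR.image_closedBall_subset_compact 1
  obtain ⟨y, -, ψ, hψ, hψy⟩ := hK.tendsto_subseq
    (x := fun n => R (v (Set.Infinite.natEmbedding _ hinf n)))
    fun n => hRK ⟨_, by simp [hv.1], rfl⟩
  obtain ⟨N, hN⟩ := Metric.cauchySeq_iff'.1 hψy.cauchySeq ε hε
  set i := Set.Infinite.natEmbedding _ hinf (ψ (N + 1))
  have hne : (i : ι) ≠ Set.Infinite.natEmbedding _ hinf (ψ N) := fun h =>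
    (Nat.succ_ne_self N) (hψ.injective ((Set.Infinite.natEmbedding _ hinf).injective
      (Subtype.ext h)))
  refine i.2 ((?_ : dist (m i) 0 = |m i|).trans_lt ((hsep hne).trans_lt (hN _ N.le_succ)))
  rw [Real.dist_0_eq_abs]

/-- The orthonormal basis `φ` consists of eigenvectors of `T`, with real eigenvalues `e`. -/
def IsEigenbasis {ι : Type*} (T : H →ₗ.[ℂ] H) (φ : HilbertBasis ι ℂ H) (e : ι → ℝ) : Prop :=
  ∀ n, (φ n, (e n : ℂ) • φ n) ∈ T.graph

section Existence

variable {ι : Type*} {T : H →ₗ.[ℂ] H}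

theorem IsEigenbasis.exists_monotone [CompleteSpace H] [Infinite ι] {b : HilbertBasis ι ℂ H}
    {E : ι → ℝ} (hb : IsEigenbasis T b E) (hE : Tendsto E cofinite atTop) :
    ∃ (φ : HilbertBasis ℕ ℂ H) (e : ℕ → ℝ),
      IsEigenbasis T φ e ∧ Monotone e ∧ Tendsto e atTop atTop := by
  obtain ⟨σ, hσ⟩ := exists_equiv_nat_monotone_comp hE
  let φ : HilbertBasis ℕ ℂ H := HilbertBasis.mk (b.orthonormal.comp σ σ.injective) (by
    rw [Set.range_comp, σ.range_eq_univ, Set.image_univ, b.dense_span])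
  refine ⟨φ, E ∘ σ, fun n => ?_, hσ, ?_⟩
  · rw [show φ n = b (σ n) from congrFun (HilbertBasis.coe_mk _ _) n]
    exact hb (σ n)
  · rw [← Nat.cofinite_eq_atTop]
    exact hE.comp σ.injective.tendsto_cofinite

theorem infinite_of_hilbertBasis (hH : ¬ FiniteDimensional ℂ H) (b : HilbertBasis ι ℂ H) :
    Infinite ι := by
  by_contra hfin
  rw [not_infinite_iff_finite] at hfin
  have := Fintype.ofFinite ι
  exact hH b.toOrthonormalBasis.toBasis.finiteDimensional_of_finite

theorem IsResolventAt.exists_isEigenbasis [CompleteSpace H] (hH : ¬ FiniteDimensional ℂ H)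
    (hT : IsSymmetric T) {c : ℝ} {R : H →L[ℂ] H} (h : IsResolventAt T c R)
    (hR : IsCompactOperator R) (hc : ∀ l : ℝ, l ≤ c → eigenspace T l = ⊥) :
    ∃ (φ : HilbertBasis ℕ ℂ H) (e : ℕ → ℝ),
      IsEigenbasis T φ e ∧ Monotone e ∧ Tendsto e atTop atTop := by
  obtain ⟨ι, b, m, hb⟩ := exists_hilbertBasis_eigenvectors hR (h.isSymmetric hT) h.injective
  have := infinite_of_hilbertBasis hH b
  have hE : IsEigenbasis T b fun i => c + (m i)⁻¹ := fun i => by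
    simpa [mem_eigenspace] using
      h.mem_eigenspace_of_apply_eq_smul (Complex.ofReal_ne_zero.2 (hb i).1) (hb i).2
  have hm (i : ι) : 0 < m i := by
    by_contra! hle
    have hbot := hc (c + (m i)⁻¹) (by simpa using hle)
    exact b.orthonormal.ne_zero i ((Submodule.eq_bot_iff _).1 hbot _ (hE i))
  refine hE.exists_monotone (tendsto_atTop_add_const_left _ _ (tendsto_inv_nhdsGT_zero.comp ?_))
  exact tendsto_nhdsWithin_iff.2
    ⟨tendsto_eigenvalue_cofinite hR b.orthonormal fun i => (hb i).2, .of_forall hm⟩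

end Existence

theorem hasSum_norm_inner_sq {ι : Type*} (φ : HilbertBasis ι ℂ H) (x : H) :
    HasSum (fun n => ‖inner ℂ (φ n) x‖ ^ 2) (‖x‖ ^ 2) := by
  have := Complex.hasSum_re (φ.hasSum_inner_mul_inner x x)
  rw [show (inner ℂ x x).re = ‖x‖ ^ 2 from inner_self_eq_norm_sq (𝕜 := ℂ) x] at this
  refine this.congr_fun fun n => ?_
  rw [← inner_conj_symm x, Complex.conj_mul']
  norm_cast

namespace IsEigenbasis

variable {ι : Type*} {T : H →ₗ.[ℂ] H} {φ : HilbertBasis ι ℂ H} {e : ι → ℝ}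

theorem inner_eq (h : IsEigenbasis T φ e) (hT : IsSymmetric T) {x x' : H}
    (hx : (x, x') ∈ T.graph) (n : ι) : inner ℂ (φ n) x' = e n * inner ℂ (φ n) x := by
  have := hT _ _ _ _ (h n) hx
  rw [inner_smul_left, Complex.conj_ofReal] at this
  exact this.symm

theorem hasSum_inner (h : IsEigenbasis T φ e) (hT : IsSymmetric T) {x x' : H}
    (hx : (x, x') ∈ T.graph) :
    HasSum (fun n => e n * ‖inner ℂ (φ n) x‖ ^ 2) (inner ℂ x x').re := by
  refine (Complex.hasSum_re (φ.hasSum_inner_mul_inner x x')).congr_fun fun n => ?_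
  rw [h.inner_eq hT hx, mul_left_comm, ← inner_conj_symm x, Complex.conj_mul',
    Complex.re_ofReal_mul]
  norm_cast

theorem mul_norm_sq_le (h : IsEigenbasis T φ e) (hT : IsSymmetric T) {x x' : H}
    (hx : (x, x') ∈ T.graph) {c : ℝ} (hc : ∀ n, inner ℂ (φ n) x = 0 ∨ c ≤ e n) :
    c * ‖x‖ ^ 2 ≤ (inner ℂ x x').re := by
  refine hasSum_le (fun n => ?_) ((hasSum_norm_inner_sq φ x).mul_left c) (h.hasSum_inner hT hx)
  rcases hc n with hn | hn
  · simp [hn]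
  · gcongr

theorem norm_add_smul_le (h : IsEigenbasis T φ e) (hT : IsSymmetric T) {x x' : H}
    (hx : (x, x') ∈ T.graph) {c C : ℝ} (hC : 0 ≤ C)
    (hc : ∀ n, inner ℂ (φ n) x = 0 ∨ |e n + c| ≤ C) : ‖x' + (c : ℂ) • x‖ ≤ C * ‖x‖ := by
  refine le_of_sq_le_sq ?_ (by positivity)
  rw [mul_pow]
  refine hasSum_le (fun n => ?_) (hasSum_norm_inner_sq φ _)
    ((hasSum_norm_inner_sq φ x).mul_left (C ^ 2))
  rw [inner_add_right, h.inner_eq hT hx, inner_smul_right, ← add_mul, ← Complex.ofReal_add,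
    norm_mul, Complex.norm_real, mul_pow, Real.norm_eq_abs]
  rcases hc n with hn | hn
  · simp [hn]
  · gcongr

theorem isBoundedBelow (h : IsEigenbasis T φ e) (hT : IsSymmetric T) {c : ℝ}
    (hc : ∀ n, c ≤ e n) : IsBoundedBelow T :=
  ⟨c, fun x => h.mul_norm_sq_le hT (T.mem_graph x) fun n => .inr (hc n)⟩

theorem inner_eq_zero (h : IsEigenbasis T φ e) (hT : IsSymmetric T) {z : ℂ} {x : H}
    (hx : x ∈ eigenspace T z) {n : ι} (hn : (e n : ℂ) ≠ z) : inner ℂ (φ n) x = 0 := by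
  have := h.inner_eq hT (mem_eigenspace.1 hx) n
  rw [inner_smul_right, ← sub_eq_zero, ← sub_mul, mul_eq_zero, sub_eq_zero] at this
  exact this.resolve_left hn.symm

theorem exists_eq (h : IsEigenbasis T φ e) (hT : IsSymmetric T) {z : ℂ}
    (hz : eigenspace T z ≠ ⊥) : ∃ n, (e n : ℂ) = z := by
  by_contra! hcon
  obtain ⟨x, hx, hx0⟩ := Submodule.exists_mem_ne_zero_of_ne_bot hz
  have hsum := hasSum_norm_inner_sq φ x
  simp_rw [h.inner_eq_zero hT hx (hcon _)] at hsum
  have : ‖x‖ ^ 2 = 0 := hsum.unique (by simp)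
  exact hx0 (by simpa using this)

theorem eigenspace_eq_span (h : IsEigenbasis T φ e) (hT : IsSymmetric T) {z : ℂ}
    (hfin : {n | (e n : ℂ) = z}.Finite) :
    eigenspace T z = Submodule.span ℂ (φ '' {n | (e n : ℂ) = z}) := by
  apply le_antisymm
  · intro x hx
    have hsum : HasSum (fun n => φ.repr x n • φ n) (∑ n ∈ hfin.toFinset, φ.repr x n • φ n) := by
      refine hasSum_sum_of_ne_finset_zero fun n hn => ?_
      rw [φ.repr_apply_apply, h.inner_eq_zero hT hx (by simpa using hn), zero_smul]
    rw [(φ.hasSum_repr x).unique hsum]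
    exact Submodule.sum_mem _ fun n hn => Submodule.smul_mem _ _
      (Submodule.subset_span ⟨n, hfin.mem_toFinset.1 hn, rfl⟩)
  · rw [Submodule.span_le]
    rintro _ ⟨n, rfl, rfl⟩
    exact h n

theorem finiteDimensional (h : IsEigenbasis T φ e) (hT : IsSymmetric T) {z : ℂ}
    (hfin : {n | (e n : ℂ) = z}.Finite) : FiniteDimensional ℂ (eigenspace T z) := by
  rw [h.eigenspace_eq_span hT hfin]
  exact FiniteDimensional.span_of_finite ℂ (hfin.image _)

theorem rank_eigenspace (h : IsEigenbasis T φ e) (hT : IsSymmetric T) {z : ℂ}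
    (hfin : {n | (e n : ℂ) = z}.Finite) :
    Cardinal.toENat (Module.rank ℂ (eigenspace T z)) = {n | (e n : ℂ) = z}.encard := by
  have hli : LinearIndepOn ℂ id (φ '' {n | (e n : ℂ) = z}) :=
    (φ.orthonormal.linearIndependent.linearIndepOn _).id_image
  rw [h.eigenspace_eq_span hT hfin, rank_span_set hli,
    ← φ.orthonormal.linearIndependent.injective.injOn.encard_image]
  rfl

end IsEigenbasis

section EigenvalueList

variable {ι : Type*} {T : H →ₗ.[ℂ] H} {φ : HilbertBasis ℕ ℂ H} {e : ℕ → ℝ}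

theorem finite_setOf_norm_sub_le {e : ι → ℝ} (he : Tendsto e cofinite atTop) (z : ℂ) (r : ℝ) :
    {n | ‖(e n : ℂ) - z‖ ≤ r}.Finite := by
  refine (eventually_cofinite.1 (he.eventually_gt_atTop (r + ‖z‖))).subset fun n hn => not_lt.2 ?_
  calc e n ≤ ‖(e n : ℂ)‖ := by simpa using le_abs_self (e n)
    _ ≤ ‖(e n : ℂ) - z‖ + ‖z‖ := norm_le_norm_sub_add _ _
    _ ≤ r + ‖z‖ := by gcongr; exact hn

theorem finite_setOf_eq {e : ι → ℝ} (he : Tendsto e cofinite atTop) (z : ℂ) :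
    {n | (e n : ℂ) = z}.Finite :=
  (finite_setOf_norm_sub_le he z 0).subset fun n hn => by
    simp [show (e n : ℂ) = z from hn]

theorem IsEigenbasis.hasPurelyDiscreteSpectrum {φ : HilbertBasis ι ℂ H} {e : ι → ℝ}
    (h : IsEigenbasis T φ e) (hT : IsSymmetric T) (he : Tendsto e cofinite atTop)
    (hs : ∀ z ∈ spectrum T, eigenspace T z ≠ ⊥) : HasPurelyDiscreteSpectrum T := by
  refine fun z hz => ⟨?_, hs z hz, h.finiteDimensional hT (finite_setOf_eq he z)⟩
  set F : Set ℂ := (fun n => (e n : ℂ)) '' {n | ‖(e n : ℂ) - z‖ ≤ 1} \ {z}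
  have hF : F.Finite := ((finite_setOf_norm_sub_le he z 1).image _).sdiff
  obtain ⟨ε, hε, hball⟩ := Metric.isOpen_iff.1 hF.isClosed.isOpen_compl z fun hz => hz.2 rfl
  refine ⟨min ε 1, by positivity, fun w hw hd => ?_⟩
  by_contra hne
  obtain ⟨n, rfl⟩ := h.exists_eq hT (hs w hw)
  refine hball (hd.trans_le (min_le_left _ _)) ⟨⟨n, ?_, rfl⟩, hne⟩
  rw [Set.mem_ofPred_eq, ← dist_eq_norm]
  exact (hd.trans_le (min_le_right _ _)).le

theorem IsEigenbasis.isEigenvalueList (h : IsEigenbasis T φ e) (hT : IsSymmetric T)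
    (hm : Monotone e) (he : Tendsto e atTop atTop) : IsEigenvalueList T e := by
  refine ⟨hm, fun l => ?_⟩
  rw [h.rank_eigenspace hT (finite_setOf_eq (by rwa [Nat.cofinite_eq_atTop]) _)]
  simp

theorem IsEigenbasis.eq_of_isEigenvalueList (h : IsEigenbasis T φ e) (hT : IsSymmetric T)
    (hm : Monotone e) (he : Tendsto e atTop atTop) {e' : ℕ → ℝ}
    (he' : IsEigenvalueList T e') : e' = e := by
  refine (eq_of_encard_eq hm he'.1 (fun l => ?_) fun l => ?_).symm
  · simpa using finite_setOf_eq (by rwa [Nat.cofinite_eq_atTop]) (l : ℂ)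
  · rw [he'.2, (h.isEigenvalueList hT hm he).2]

end EigenvalueList

end Eigenbasis

/-! ### Comparison of ordered eigenvalues -/

section Comparison

variable {H : Type*} [NormedAddCommGroup H] [InnerProductSpace ℂ H]

theorem re_inner_add_smul (x y : H) (c : ℝ) :
    (inner ℂ x (y + (c : ℂ) • x)).re = (inner ℂ x y).re + c * ‖x‖ ^ 2 := by
  rw [inner_add_right, inner_smul_right, Complex.add_re, Complex.re_ofReal_mul,
    ← RCLike.re_to_complex (x := inner ℂ x x), inner_self_eq_norm_sq]

theorem norm_sq_add_le_norm_add_smul_sq {x y : H} {s : ℝ} (hs : 0 ≤ s)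
    (h : 0 ≤ (inner ℂ x y).re) : ‖y‖ ^ 2 + s ^ 2 * ‖x‖ ^ 2 ≤ ‖y + (s : ℂ) • x‖ ^ 2 := by
  have hre : RCLike.re (inner ℂ y x) = (inner ℂ x y).re := inner_re_symm (𝕜 := ℂ) y x
  rw [norm_add_sq (𝕜 := ℂ), inner_smul_right, norm_smul, Complex.norm_real, mul_pow,
    Real.norm_eq_abs, sq_abs, RCLike.re_to_complex, Complex.re_ofReal_mul,
    ← RCLike.re_to_complex, hre]
  linarith [mul_nonneg hs h]

theorem exists_mem_ne_zero_forall_inner_eq_zero {ι : Type*} [Fintype ι] {W : Submodule ℂ H}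
    [FiniteDimensional ℂ W] (v : ι → H) (hW : Fintype.card ι < Module.finrank ℂ W) :
    ∃ x ∈ W, x ≠ 0 ∧ ∀ i, inner ℂ (v i) x = 0 := by
  let L : W →ₗ[ℂ] (ι → ℂ) := LinearMap.pi fun i => (innerₛₗ ℂ (v i)).comp W.subtype
  obtain ⟨x, hx, hx0⟩ := Submodule.exists_mem_ne_zero_of_ne_bot
    (LinearMap.ker_ne_bot_of_finrank_lt (f := L) (by simpa using hW))
  exact ⟨x, x.2, by simpa using hx0, fun i => congrFun (LinearMap.mem_ker.1 hx) i⟩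

variable {T T' : H →ₗ.[ℂ] H} {φ φ' : HilbertBasis ℕ ℂ H} {e e' : ℕ → ℝ} {c : ℝ}

theorem IsEigenbasis.exists_trial_vector (h : IsEigenbasis T φ e) (n : ℕ) (v : Fin n → H) :
    ∃ x ∈ T.domain, x ≠ 0 ∧ (∀ m < n, ∀ hm, inner ℂ (v ⟨m, hm⟩) x = 0) ∧
      ∀ m, n < m → inner ℂ (φ m) x = 0 := by
  let f (i : Fin (n + 1)) : H := φ i
  have hf : LinearIndependent ℂ f :=
    φ.orthonormal.linearIndependent.comp _ Fin.val_injective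
  have hfin : FiniteDimensional ℂ (Submodule.span ℂ (Set.range f)) :=
    FiniteDimensional.span_of_finite ℂ (Set.finite_range f)
  obtain ⟨x, hx, hx0, hvx⟩ := exists_mem_ne_zero_forall_inner_eq_zero v
    (W := Submodule.span ℂ (Set.range f)) (by rw [finrank_span_eq_card hf]; simp)
  refine ⟨x, ?_, hx0, fun m _ hm => hvx ⟨m, hm⟩, fun m hm => ?_⟩
  · refine Submodule.span_le.2 ?_ hx
    rintro _ ⟨i, rfl⟩
    exact LinearPMap.mem_domain_of_mem_graph (h i)
  · suffices hle : Submodule.span ℂ (Set.range f) ≤ LinearMap.ker (innerₛₗ ℂ (φ m)) from hle hx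
    rw [Submodule.span_le]
    rintro _ ⟨i, rfl⟩
    exact φ.orthonormal.2 (by have := i.2; omega)

/-- The min-max argument: test `T'` on a combination of `φ 0, …, φ n` that is orthogonal to
`φ' 0, …, φ' (n - 1)`. -/
theorem IsEigenbasis.add_le_mul_add (h : IsEigenbasis T φ e) (h' : IsEigenbasis T' φ' e')
    (hT : IsSymmetric T) (hT' : IsSymmetric T') (hm : Monotone e) (hm' : Monotone e')
    (hc : ∀ n, 0 ≤ e n + c) {κ : ℝ} (hκ : 0 ≤ κ)
    (hrel : ∀ x x', (x, x') ∈ T.graph →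
      ∃ x'', (x, x'') ∈ T'.graph ∧ ‖x'' + (c : ℂ) • x‖ ≤ κ * ‖x' + (c : ℂ) • x‖) (n : ℕ) :
    e' n + c ≤ κ * (e n + c) := by
  obtain ⟨x, hxT, hx0, hlow, hhigh⟩ := h.exists_trial_vector n fun m => φ' m
  have hx := T.mem_graph ⟨x, hxT⟩
  obtain ⟨x'', hx'', hle⟩ := hrel _ _ hx
  have hlower : e' n * ‖x‖ ^ 2 ≤ (inner ℂ x x'').re :=
    h'.mul_norm_sq_le hT' hx'' fun m => (lt_or_ge m n).imp (fun hmn => hlow m hmn hmn) (@hm' n m)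
  have hupper : ‖T ⟨x, hxT⟩ + (c : ℂ) • x‖ ≤ (e n + c) * ‖x‖ :=
    h.norm_add_smul_le hT hx (hc n) fun m => (lt_or_ge n m).imp (hhigh m) fun hmn => by
      rw [abs_of_nonneg (hc m)]
      linarith [hm hmn]
  refine le_of_mul_le_mul_right (?_ : _ * ‖x‖ ^ 2 ≤ _ * ‖x‖ ^ 2) (by positivity)
  calc (e' n + c) * ‖x‖ ^ 2
      ≤ (inner ℂ x (x'' + (c : ℂ) • x)).re := by
        rw [re_inner_add_smul, add_mul]
        gcongr
    _ ≤ ‖x‖ * ‖x'' + (c : ℂ) • x‖ := (Complex.re_le_norm _).trans (norm_inner_le_norm _ _)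
    _ ≤ ‖x‖ * (κ * ((e n + c) * ‖x‖)) := by gcongr; exact hle.trans (by gcongr)
    _ = κ * (e n + c) * ‖x‖ ^ 2 := by ring

/-- `T'` is a perturbation of `T` in the sense of Kato: the domains agree and
`‖(T' - T) x‖ ≤ δ ‖(T + c) x‖`. -/
structure IsRelativePerturbation (T T' : H →ₗ.[ℂ] H) (c δ : ℝ) : Prop where
  domain_eq : T'.domain = T.domain
  norm_sub_le {x x' x'' : H} (hx : (x, x') ∈ T.graph) (hx' : (x, x'') ∈ T'.graph) :
    ‖x'' - x'‖ ≤ δ * ‖x' + (c : ℂ) • x‖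

theorem exists_mem_graph_of_domain_eq (h : T'.domain = T.domain) {x x' : H}
    (hx : (x, x') ∈ T.graph) : ∃ x'', (x, x'') ∈ T'.graph :=
  ⟨_, T'.mem_graph ⟨x, h ▸ LinearPMap.mem_domain_of_mem_graph hx⟩⟩

/-- With `y = (T + c) x` and `s = -(l + c)`, the relative bound reads `‖y + s x‖ ≤ δ ‖y‖`, while
`‖y + s x‖² ≥ ‖y‖² + s² ‖x‖²` since `⟪x, y⟫ ≥ 0`. -/
theorem IsRelativePerturbation.add_nonneg {δ : ℝ} (hr : IsRelativePerturbation T T' c δ)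
    (hδ : δ < 1) (hc : ∀ x x', (x, x') ∈ T.graph → 0 ≤ (inner ℂ x (x' + (c : ℂ) • x)).re)
    {l : ℝ} {x : H} (hx0 : x ≠ 0) (hx : x ∈ eigenspace T' l) : 0 ≤ l + c := by
  obtain ⟨x', hx'⟩ := exists_mem_graph_of_domain_eq hr.domain_eq.symm (mem_eigenspace.1 hx)
  by_contra! hl
  set y := x' + (c : ℂ) • x
  have hrel : ‖y + ((-(l + c) : ℝ) : ℂ) • x‖ ≤ δ * ‖y‖ := by
    convert hr.norm_sub_le hx' (mem_eigenspace.1 hx) using 1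
    rw [← norm_neg]
    congr 1
    simp only [y]
    push_cast
    module
  have hsq := norm_sq_add_le_norm_add_smul_sq (neg_pos.2 hl).le (hc x x' hx')
  rw [neg_sq] at hsq
  have hpos : 0 < (l + c) ^ 2 * ‖x‖ ^ 2 := mul_pos (sq_pos_of_neg hl) (by positivity)
  have hle : ‖y + ((-(l + c) : ℝ) : ℂ) • x‖ ≤ ‖y‖ :=
    hrel.trans (mul_le_of_le_one_left (norm_nonneg _) hδ.le)
  nlinarith [norm_nonneg (y + ((-(l + c) : ℝ) : ℂ) • x)]

theorem IsRelativePerturbation.abs_sub_le {δ : ℝ} (hr : IsRelativePerturbation T T' c δ)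
    (hδ₀ : 0 ≤ δ) (hδ : δ < 1) (h : IsEigenbasis T φ e) (h' : IsEigenbasis T' φ' e')
    (hT : IsSymmetric T) (hT' : IsSymmetric T') (hm : Monotone e) (hm' : Monotone e')
    (hc : ∀ n, 0 ≤ e n + c) (n : ℕ) : |e' n - e n| ≤ δ * (e n + c) := by
  have hnonneg (x x' : H) (hx : (x, x') ∈ T.graph) :
      0 ≤ (inner ℂ x (x' + (c : ℂ) • x)).re := by
    have := h.mul_norm_sq_le hT hx fun n => .inr (neg_le_iff_add_nonneg.2 (hc n))
    rw [re_inner_add_smul]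
    linarith
  have hc' (n : ℕ) : 0 ≤ e' n + c := hr.add_nonneg hδ hnonneg (φ'.orthonormal.ne_zero n) (h' n)
  have hupper : e' n + c ≤ (1 + δ) * (e n + c) := by
    refine h.add_le_mul_add h' hT hT' hm hm' hc (by positivity) (fun x x' hx => ?_) n
    obtain ⟨x'', hx''⟩ := exists_mem_graph_of_domain_eq hr.domain_eq hx
    refine ⟨x'', hx'', ?_⟩
    have htri := norm_add_le (x'' - x') (x' + (c : ℂ) • x)
    rw [← add_assoc, sub_add_cancel] at htri
    linarith [hr.norm_sub_le hx hx'']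
  have hlower : e n + c ≤ (1 - δ)⁻¹ * (e' n + c) := by
    refine h'.add_le_mul_add h hT' hT hm' hm hc' (by simpa using hδ.le) (fun x x'' hx'' => ?_) n
    obtain ⟨x', hx⟩ := exists_mem_graph_of_domain_eq hr.domain_eq.symm hx''
    refine ⟨x', hx, ?_⟩
    rw [inv_mul_eq_div, le_div_iff₀ (sub_pos.2 hδ)]
    have htri := _root_.norm_sub_le (x'' + (c : ℂ) • x) (x'' - x')
    rw [show x'' + (c : ℂ) • x - (x'' - x') = x' + (c : ℂ) • x by abel] at htri
    linarith [hr.norm_sub_le hx hx'']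
  rw [inv_mul_eq_div, le_div_iff₀ (sub_pos.2 hδ)] at hlower
  rw [abs_le]
  constructor <;> linarith

end Comparison

/-! ### Diagonal operators with respect to an orthonormal basis -/

section Diagonal

variable {H : Type*} [NormedAddCommGroup H] [InnerProductSpace ℂ H] {ι : Type*}
  (b : HilbertBasis ι ℂ H)

theorem eq_of_forall_inner_eq {x y : H} (h : ∀ i, inner ℂ (b i) x = inner ℂ (b i) y) : x = y := by
  apply b.repr.injective
  ext i
  rw [b.repr_apply_apply, b.repr_apply_apply, h]

theorem exists_forall_inner_eq {c : ι → ℂ} (hc : Summable fun i => ‖c i‖ ^ 2) :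
    ∃ x, ∀ i, inner ℂ (b i) x = c i := by
  have hmem : Memℓp c 2 := memℓp_gen (by simpa using hc)
  refine ⟨b.repr.symm ⟨c, hmem⟩, fun i => ?_⟩
  rw [← b.repr_apply_apply, LinearIsometryEquiv.apply_symm_apply]

variable {m : ι → ℂ} {C : ℝ}

theorem norm_le_of_forall_inner_eq_mul {x y : H} (hC : 0 ≤ C) (hm : ∀ i, ‖m i‖ ≤ C)
    (h : ∀ i, inner ℂ (b i) y = m i * inner ℂ (b i) x) : ‖y‖ ≤ C * ‖x‖ := by
  refine le_of_sq_le_sq ?_ (by positivity)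
  rw [mul_pow]
  refine hasSum_le (fun i => ?_) (hasSum_norm_inner_sq b y)
    ((hasSum_norm_inner_sq b x).mul_left (C ^ 2))
  rw [h, norm_mul, mul_pow]
  gcongr
  exact hm i

theorem exists_diagonalOperator (hC : 0 ≤ C) (hm : ∀ i, ‖m i‖ ≤ C) :
    ∃ D : H →L[ℂ] H, ∀ x i, inner ℂ (b i) (D x) = m i * inner ℂ (b i) x := by
  have h (x : H) : ∃ y, ∀ i, inner ℂ (b i) y = m i * inner ℂ (b i) x := by
    refine exists_forall_inner_eq b (.of_nonneg_of_le (fun i => by positivity) (fun i => ?_)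
      ((hasSum_norm_inner_sq b x).summable.mul_left (C ^ 2)))
    rw [norm_mul, mul_pow]
    gcongr
    exact hm i
  choose D hD using h
  exact ⟨LinearMap.mkContinuous
    { toFun := D
      map_add' x y := eq_of_forall_inner_eq b fun i => by
        rw [hD, inner_add_right, inner_add_right, hD, hD, mul_add]
      map_smul' c x := eq_of_forall_inner_eq b fun i => by
        rw [hD, inner_smul_right, RingHom.id_apply, inner_smul_right, hD, mul_left_comm] } C
    fun x => norm_le_of_forall_inner_eq_mul b hC hm (hD x), hD⟩

open Classical in
/-- The diagonal operator with bounded entries `m` in the orthonormal basis `b`. If `m` is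
unbounded, there is no such operator and the value is `0`. -/
noncomputable def diagonalOperator (m : ι → ℂ) : H →L[ℂ] H :=
  if h : ∃ D : H →L[ℂ] H, ∀ x i, inner ℂ (b i) (D x) = m i * inner ℂ (b i) x then h.choose else 0

theorem inner_diagonalOperator (hm : ∀ i, ‖m i‖ ≤ C) (x : H) (i : ι) :
    inner ℂ (b i) (diagonalOperator b m x) = m i * inner ℂ (b i) x := by
  have h := exists_diagonalOperator b ((norm_nonneg _).trans (hm i)) hm
  rw [diagonalOperator, dif_pos h]
  exact h.choose_spec x i

theorem norm_diagonalOperator_le (hC : 0 ≤ C) (hm : ∀ i, ‖m i‖ ≤ C) :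
    ‖diagonalOperator b m‖ ≤ C :=
  ContinuousLinearMap.opNorm_le_bound _ hC fun x =>
    norm_le_of_forall_inner_eq_mul b hC hm (inner_diagonalOperator b hm x)

theorem inner_sum_rankOne [DecidableEq ι] (s : Finset ι) (x : H) (j : ι) :
    inner ℂ (b j) ((∑ i ∈ s, m i • InnerProductSpace.rankOne ℂ (b i) (b i)) x) =
      (if j ∈ s then m j else 0) * inner ℂ (b j) x := by
  simp [orthonormal_iff_ite.1 b.orthonormal, ite_mul]

theorem isCompactOperator_sum_rankOne (s : Finset ι) :
    IsCompactOperator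
      (∑ i ∈ s, m i • InnerProductSpace.rankOne ℂ (b i) (b i) : H →L[ℂ] H) := by
  suffices h : (∑ i ∈ s, m i • InnerProductSpace.rankOne ℂ (b i) (b i)) ∈
      compactOperator (RingHom.id ℂ) H H from h
  refine Submodule.sum_mem _ fun i _ => Submodule.smul_mem _ _ ?_
  exact (isCompactOperator_of_locallyCompactSpace_dom (innerSL ℂ (b i))).clm_comp
    (ContinuousLinearMap.toSpanSingleton ℂ (b i))

theorem isCompactOperator_diagonalOperator [CompleteSpace H] (hm : ∀ i, ‖m i‖ ≤ C)
    (h0 : Tendsto m cofinite (𝓝 0)) : IsCompactOperator (diagonalOperator b m) := by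
  classical
  refine isCompactOperator_of_tendsto (l := atTop) (F := fun s : Finset ι =>
    ∑ i ∈ s, m i • InnerProductSpace.rankOne ℂ (b i) (b i)) ?_
    (.of_forall fun s => isCompactOperator_sum_rankOne b s)
  refine Metric.tendsto_atTop.2 fun ε hε => ?_
  have hfin : {i | ¬ ‖m i‖ < ε / 2}.Finite :=
    h0.norm.eventually_lt_const (by simpa using hε)
  refine ⟨hfin.toFinset, fun s hs => ?_⟩
  rw [dist_comm, dist_eq_norm]
  refine (ContinuousLinearMap.opNorm_le_bound _ (half_pos hε).le fun x => ?_).trans_lt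
    (half_lt_self hε)
  refine norm_le_of_forall_inner_eq_mul b (m := fun i => if i ∈ s then 0 else m i)
    (half_pos hε).le (fun i => ?_) fun i => ?_
  · split_ifs with hi
    · simpa using (half_pos hε).le
    · by_contra! h
      exact hi (hs (hfin.mem_toFinset.2 (not_lt.2 h.le)))
  · rw [sub_apply, inner_sub_right, inner_diagonalOperator b hm, inner_sum_rankOne, ← sub_mul]
    split_ifs <;> simp

end Diagonal

end UnboundedOperator

open MeasureTheory in
theorem setIntegral_Icc_fderiv_eq_zero {n : ℕ} {E : Type*} [NormedAddCommGroup E]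
    [NormedSpace ℝ E] [CompleteSpace E] {F : (Fin (n + 1) → ℝ) → E} (hF : ContDiff ℝ 1 F)
    (hp : ∀ i x, F (x + Pi.single i 1) = F x) (v : Fin (n + 1) → ℝ) :
    ∫ x in Set.Icc (0 : Fin (n + 1) → ℝ) 1, fderiv ℝ F x v = 0 := by
  have hsum (x) : ∑ i, (v i • fderiv ℝ F x) (Pi.single i 1) = fderiv ℝ F x v := by
    simp_rw [smul_apply, ← map_smul, ← map_sum]
    rw [← pi_eq_sum_univ' v]
  have hface (i : Fin (n + 1)) (y : Fin n → ℝ) :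
      F (i.insertNth 1 y) = F (i.insertNth 0 y) := by
    rw [← hp i (i.insertNth 0 y)]
    congr 1
    ext k
    rcases eq_or_ne k i with rfl | hk
    · simp
    · obtain ⟨m, rfl⟩ := Fin.exists_succAbove_eq hk
      simp
  have hcont : Continuous fun x => fderiv ℝ F x v :=
    (hF.continuous_fderiv one_ne_zero).clm_apply continuous_const
  simp_rw [← hsum] at hcont ⊢
  rw [integral_divergence_of_hasFDerivAt_off_countable' 0 1 (fun _ => zero_le_one)
    (fun i x => v i • F x) (fun i x => v i • fderiv ℝ F x) ∅ Set.countable_empty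
    (fun i => (hF.continuous.const_smul (v i)).continuousOn)
    (fun x _ i => (hF.differentiable one_ne_zero x).hasFDerivAt.const_smul (v i))
    hcont.continuousOn.integrableOn_Icc]
  refine Finset.sum_eq_zero fun i _ => sub_eq_zero.2 ?_
  simp only [Pi.one_apply, Pi.zero_apply, hface]

open MeasureTheory in
/-- Multiplication by an `L²` function is bounded on the range of a bounded operator into `L^∞`. -/
theorem exists_mul_clm_of_ae_norm_le {X E : Type*} [MeasurableSpace X] {μ : Measure X}
    [NormedAddCommGroup E] [NormedSpace ℂ E] (T : E →L[ℂ] Lp ℂ 2 μ) {C : ℝ} (hC : 0 ≤ C)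
    (hT : ∀ f, ∀ᵐ x ∂μ, ‖T f x‖ ≤ C * ‖f‖) (v : Lp ℂ 2 μ) :
    ∃ G : E →L[ℂ] Lp ℂ 2 μ, (∀ f, G f =ᵐ[μ] fun x => v x * T f x) ∧ ‖G‖ ≤ C * ‖v‖ := by
  have hbound (f : E) : ∀ᵐ x ∂μ, ‖v x * T f x‖ ≤ C * ‖f‖ * ‖v x‖ := by
    filter_upwards [hT f] with x hx
    rw [norm_mul, mul_comm]
    gcongr
  have hmem (f : E) : MemLp (fun x => v x * T f x) 2 μ :=
    (Lp.memLp v).of_le_mul ((Lp.aestronglyMeasurable v).mul (Lp.aestronglyMeasurable _)) (hbound f)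
  let G : E →ₗ[ℂ] Lp ℂ 2 μ :=
    { toFun := fun f => (hmem f).toLp
      map_add' := fun f g => by
        rw [← MemLp.toLp_add, MemLp.toLp_eq_toLp_iff, map_add]
        filter_upwards [Lp.coeFn_add (T f) (T g)] with x hx
        simp only [hx, Pi.add_apply, mul_add]
      map_smul' := fun c f => by
        rw [RingHom.id_apply, ← MemLp.toLp_const_smul, MemLp.toLp_eq_toLp_iff, map_smul]
        filter_upwards [Lp.coeFn_smul c (T f)] with x hx
        simp only [hx, Pi.smul_apply, smul_eq_mul, mul_left_comm] }
  have hG (f : E) : ‖G f‖ ≤ C * ‖v‖ * ‖f‖ := by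
    rw [mul_right_comm]
    refine Lp.norm_le_mul_norm_of_ae_le_mul ?_
    filter_upwards [hbound f, (hmem f).coeFn_toLp] with x hx hGx
    exact (congrArg norm hGx).trans_le hx
  exact ⟨G.mkContinuous _ hG, fun f => (hmem f).coeFn_toLp,
    G.mkContinuous_norm_le (by positivity) hG⟩

theorem summable_inv_mul_sq_add {c l : ℝ} (hc : 0 < c) (hl : 0 < l) :
    Summable fun n : ℤ => (c * (n : ℝ) ^ 2 + l)⁻¹ := by
  refine Summable.of_norm_bounded_eventually
    ((Real.summable_one_div_int_pow.2 one_lt_two).mul_left c⁻¹) ?_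
  filter_upwards [(Set.finite_singleton (0 : ℤ)).compl_mem_cofinite] with n hn
  have hn' : 0 < (n : ℝ) ^ 2 := by
    have : n ≠ 0 := hn
    positivity
  rw [Real.norm_of_nonneg (by positivity), one_div, ← mul_inv]
  gcongr
  linarith

namespace BlochFiber

open Filter MeasureTheory Topology UnboundedOperator

/-! ### Fourier series on the torus -/

section Fourier

variable {a b : Plane}

/-- The plane wave `x ↦ exp (i g · x)`. -/
noncomputable def planeWave (g x : Plane) : ℂ := Complex.exp (Complex.I * (inner ℝ g x : ℝ))

theorem contDiff_planeWave (g : Plane) {n : WithTop ℕ∞} : ContDiff ℝ n (planeWave g) :=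
  (contDiff_const.mul (Complex.ofRealCLM.contDiff.comp (innerSL ℝ g).contDiff)).cexp

theorem continuous_planeWave (g : Plane) : Continuous (planeWave g) :=
  (contDiff_planeWave g (n := 0)).continuous

theorem norm_planeWave (g x : Plane) : ‖planeWave g x‖ = 1 := by
  rw [planeWave, mul_comm, Complex.norm_exp_ofReal_mul_I]

theorem planeWave_neg (g x : Plane) : planeWave (-g) x = starRingEnd ℂ (planeWave g x) := by
  rw [planeWave, planeWave, ← Complex.exp_conj]
  simp

theorem pderiv_planeWave (j : Fin 2) (g x : Plane) :
    pderiv j (planeWave g) x = Complex.I * g j * planeWave g x := by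
  have hphase : HasFDerivAt (fun y : Plane => Complex.I * ((inner ℝ g y : ℝ) : ℂ))
      (Complex.I • (Complex.ofRealCLM ∘L innerSL ℝ g)) x :=
    (Complex.ofRealCLM.hasFDerivAt.comp x (innerSL ℝ g).hasFDerivAt).const_mul Complex.I
  rw [pderiv, show fderiv ℝ (planeWave g) x = _ from hphase.cexp.fderiv]
  simp [planeWave, EuclideanSpace.inner_single_right, mul_comm]

theorem neg_mem_dualLattice {g : Plane} (hg : g ∈ dualLattice a b) : -g ∈ dualLattice a b := by
  intro l hl
  obtain ⟨m, hm⟩ := hg l hl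
  exact ⟨-m, by rw [inner_neg_left, hm]; push_cast; ring⟩

theorem isTorusSmooth_planeWave {g : Plane} (hg : g ∈ dualLattice a b) :
    IsTorusSmooth a b (planeWave g) := by
  refine ⟨contDiff_planeWave g, fun l hl r => ?_⟩
  obtain ⟨m, hm⟩ := hg l hl
  have hexp : Complex.exp (Complex.I * ((2 * Real.pi * m : ℝ) : ℂ)) = 1 := by
    rw [← Complex.exp_int_mul_two_pi_mul_I m]
    push_cast
    ring_nf
  rw [planeWave, planeWave, inner_add_right, hm, Complex.ofReal_add, mul_add, Complex.exp_add,
    hexp, mul_one]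

/-- The dual lattice vector `n₀ a* + n₁ b*`, where `a*, b*` is the basis of `Γ*` dual to `a, b`. -/
noncomputable def freq (hab : LinearIndependent ℝ ![a, b]) (n : Fin 2 → ℤ) : Plane :=
  (InnerProductSpace.toDual ℝ Plane).symm ((2 * Real.pi) • ∑ i, (n i : ℝ) •
    ((ContinuousLinearMap.proj i : (Fin 2 → ℝ) →L[ℝ] ℝ) ∘L
      (coords a b hab : Plane →L[ℝ] Fin 2 → ℝ)))

variable (hab : LinearIndependent ℝ ![a, b])

theorem inner_freq (n : Fin 2 → ℤ) (x : Plane) :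
    inner ℝ (freq hab n) x = 2 * Real.pi * ∑ i, n i * coords a b hab x i := by
  rw [freq, InnerProductSpace.toDual_symm_apply]
  simp [mul_add]

theorem freq_mem_dualLattice (n : Fin 2 → ℤ) : freq hab n ∈ dualLattice a b := by
  intro g hg
  choose m hm using coords_add_lattice hab hg 0
  simp only [zero_add, map_zero, Pi.zero_apply] at hm
  exact ⟨∑ i, n i * m i, by simp [inner_freq, hm]⟩

instance isFiniteMeasure_torusMeasure (a b : Plane) : IsFiniteMeasure (torusMeasure a b) := by
  unfold torusMeasure
  infer_instance

theorem measurePreserving_coords_symm :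
    MeasurePreserving (coords a b hab).symm (volume.restrict (Set.Icc (0 : Fin 2 → ℝ) 1))
      (torusMeasure a b) :=
  ⟨(coords a b hab).symm.continuous.measurable, (torusMeasure_eq_map hab).symm⟩

section Parametrization

/-- The measure on `ℝ / ℤ` used by Mathlib's multivariate Fourier series. -/
noncomputable local instance haarMeasureSpace : MeasureSpace UnitAddCircle :=
  ⟨AddCircle.haarAddCircle⟩

theorem measurePreserving_measurableEquivPiIoc {d : Type*} [Fintype d] :
    MeasurePreserving
      (fun t : UnitAddTorus d => (UnitAddTorus.measurableEquivPiIoc (0 : d → ℝ) t : d → ℝ))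
      volume (volume.restrict (Set.Icc 0 1)) := by
  let I : Set (d → ℝ) := {x | ∀ i, x i ∈ Set.Ioc ((0 : d → ℝ) i) ((0 : d → ℝ) i + 1)}
  have hI : I = Set.univ.pi fun i => Set.Ioc ((0 : d → ℝ) i) ((1 : d → ℝ) i) := by
    ext x
    simp [I]
  have hIcc : I =ᵐ[volume] Set.Icc (0 : d → ℝ) 1 :=
    hI ▸ Measure.univ_pi_Ioc_ae_eq_Icc (μ := fun _ : d => (volume : Measure ℝ))
  have hval : MeasurePreserving (Subtype.val : I → d → ℝ)
      (Measure.comap Subtype.val volume) (volume.restrict I) :=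
    ⟨measurable_subtype_coe,
      map_comap_subtype_coe (MeasurableSet.univ_pi' fun _ => measurableSet_Ioc) _⟩
  rw [← Measure.restrict_congr_set hIcc]
  exact hval.comp (UnitAddTorus.measurePreserving_equivPiIoc 0)

/-- The parametrization of `ℝ² / Γ` by the standard torus `(ℝ / ℤ)²`, with values in the cell. -/
noncomputable def torusParam (t : UnitAddTorus (Fin 2)) : Plane :=
  (coords a b hab).symm (UnitAddTorus.measurableEquivPiIoc (0 : Fin 2 → ℝ) t : Fin 2 → ℝ)

theorem coe_coords_torusParam (t : UnitAddTorus (Fin 2)) (i : Fin 2) :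
    ((coords a b hab (torusParam hab t) i : ℝ) : UnitAddCircle) = t i := by
  rw [torusParam, ContinuousLinearEquiv.apply_symm_apply]
  exact congrFun ((UnitAddTorus.measurableEquivPiIoc (0 : Fin 2 → ℝ)).symm_apply_apply t) i

theorem measurePreserving_torusParam :
    MeasurePreserving (torusParam hab) volume (torusMeasure a b) :=
  (measurePreserving_coords_symm hab).comp measurePreserving_measurableEquivPiIoc

theorem planeWave_freq_torusParam (n : Fin 2 → ℤ) (t : UnitAddTorus (Fin 2)) :
    planeWave (freq hab n) (torusParam hab t) = UnitAddTorus.mFourier n t := by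
  conv_rhs => rw [← funext (coe_coords_torusParam hab t)]
  simp only [planeWave, inner_freq, UnitAddTorus.mFourier, ContinuousMap.coe_mk,
    fourier_coe_apply]
  rw [← Complex.exp_sum, Finset.mul_sum]
  push_cast
  rw [Finset.mul_sum]
  congr! 2
  ring

/-- The class in `L²(ℝ² / Γ)` of a continuous function. -/
noncomputable def toTorusL2 (a b : Plane) {f : Plane → ℂ} (hf : Continuous f) : TorusL2 a b :=
  (memLp_of_continuous a b hf).toLp

theorem coeFn_toTorusL2 {f : Plane → ℂ} (hf : Continuous f) :
    toTorusL2 a b hf =ᵐ[torusMeasure a b] f :=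
  (memLp_of_continuous a b hf).coeFn_toLp

theorem inner_toTorusL2 {f : Plane → ℂ} (hf : Continuous f) (u : TorusL2 a b) :
    inner ℂ (toTorusL2 a b hf) u = ∫ x, u x * starRingEnd ℂ (f x) ∂torusMeasure a b := by
  rw [L2.inner_def]
  refine integral_congr_ae ?_
  filter_upwards [coeFn_toTorusL2 (a := a) (b := b) hf] with x hx
  rw [hx]
  rfl

/-- The isometry `u ↦ u ∘ torusParam` from `L²(ℝ² / Γ)` to `L²((ℝ / ℤ)²)`. -/
noncomputable def compTorusParam :
    TorusL2 a b →ₗᵢ[ℂ] Lp ℂ 2 (volume : Measure (UnitAddTorus (Fin 2))) :=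
  Lp.compMeasurePreservingₗᵢ ℂ (torusParam hab) (measurePreserving_torusParam hab)

theorem compTorusParam_planeWave (n : Fin 2 → ℤ) :
    compTorusParam hab (toTorusL2 a b (continuous_planeWave (freq hab n))) =
      UnitAddTorus.mFourierBasis n := by
  have hP := measurePreserving_torusParam hab
  rw [UnitAddTorus.coe_mFourierBasis]
  apply Lp.ext
  filter_upwards [Lp.coeFn_compMeasurePreserving (toTorusL2 a b (continuous_planeWave _)) hP,
    hP.quasiMeasurePreserving.ae_eq (coeFn_toTorusL2 (continuous_planeWave (freq hab n))),
    UnitAddTorus.coeFn_mFourierLp 2 n] with t hcomp hwave hmono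
  rw [hmono, ← planeWave_freq_torusParam hab]
  exact hcomp.trans hwave

theorem orthonormal_planeWave :
    Orthonormal ℂ fun n => toTorusL2 a b (continuous_planeWave (freq hab n)) := by
  rw [← (compTorusParam hab).orthonormal_comp_iff]
  convert UnitAddTorus.mFourierBasis.orthonormal using 1
  exact funext (compTorusParam_planeWave hab)

theorem orthogonal_span_planeWave :
    (Submodule.span ℂ (Set.range fun n =>
      toTorusL2 a b (continuous_planeWave (freq hab n))))ᗮ = ⊥ := by
  refine (Submodule.eq_bot_iff _).2 fun u hu => (compTorusParam hab).injective ?_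
  rw [map_zero]
  refine eq_of_forall_inner_eq UnitAddTorus.mFourierBasis fun n => ?_
  rw [← compTorusParam_planeWave hab, LinearIsometry.inner_map_map, inner_zero_right]
  exact (Submodule.mem_orthogonal _ _).1 hu _ (Submodule.subset_span ⟨n, rfl⟩)

end Parametrization

/-- The Fourier basis of `L²(ℝ² / Γ)`. -/
noncomputable def fourierBasis : HilbertBasis (Fin 2 → ℤ) ℂ (TorusL2 a b) :=
  .mkOfOrthogonalEqBot (orthonormal_planeWave hab) (orthogonal_span_planeWave hab)

theorem fourierBasis_apply (n : Fin 2 → ℤ) :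
    fourierBasis hab n = toTorusL2 a b (continuous_planeWave (freq hab n)) := by
  rw [fourierBasis, HilbertBasis.coe_mkOfOrthogonalEqBot]

theorem inner_fourierBasis (n : Fin 2 → ℤ) (u : TorusL2 a b) :
    inner ℂ (fourierBasis hab n) u = ∫ x, u x * planeWave (-freq hab n) x ∂torusMeasure a b := by
  simp_rw [fourierBasis_apply, inner_toTorusL2, planeWave_neg]

include hab in
theorem not_finiteDimensional_torusL2 : ¬ FiniteDimensional ℂ (TorusL2 a b) := fun _ =>
  have := (fourierBasis hab).orthonormal.linearIndependent.finite
  not_finite (Fin 2 → ℤ)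

end Fourier

/-! ### Weak derivatives -/

section WeakDerivative

variable {a b : Plane}

theorem pderiv_mul {f g : Plane → ℂ} (hf : ContDiff ℝ 1 f) (hg : ContDiff ℝ 1 g) (j : Fin 2)
    (x : Plane) : pderiv j (fun y => f y * g y) x = f x * pderiv j g x + pderiv j f x * g x := by
  rw [pderiv, fderiv_fun_mul (hf.differentiable one_ne_zero x) (hg.differentiable one_ne_zero x)]
  simp [pderiv, mul_comm]

theorem continuous_pderiv {f : Plane → ℂ} (hf : ContDiff ℝ 1 f) (j : Fin 2) :
    Continuous (pderiv j f) :=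
  (hf.continuous_fderiv one_ne_zero).clm_apply continuous_const

theorem contDiff_conj {f : Plane → ℂ} {n : WithTop ℕ∞} (hf : ContDiff ℝ n f) :
    ContDiff ℝ n fun y => starRingEnd ℂ (f y) :=
  Complex.conjCLE.contDiff.comp hf

theorem pderiv_conj {f : Plane → ℂ} (hf : ContDiff ℝ 1 f) (j : Fin 2) (x : Plane) :
    pderiv j (fun y => starRingEnd ℂ (f y)) x = starRingEnd ℂ (pderiv j f x) := by
  have h := Complex.conjCLE.toContinuousLinearMap.hasFDerivAt.comp x
    (hf.differentiable one_ne_zero x).hasFDerivAt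
  rw [pderiv, show fderiv ℝ (fun y => starRingEnd ℂ (f y)) x = _ from h.fderiv]
  rfl

theorem integrable_of_continuous {f : Plane → ℂ} (hf : Continuous f) :
    Integrable f (torusMeasure a b) :=
  (memLp_of_continuous a b hf).integrable one_le_two

theorem IsWeakDeriv.add {j : Fin 2} {u g v h : TorusL2 a b} (hu : IsWeakDeriv a b j u g)
    (hv : IsWeakDeriv a b j v h) : IsWeakDeriv a b j (u + v) (g + h) :=
  (weakDerivGraph a b j).add_mem (x := (u, g)) (y := (v, h)) hu hv

theorem IsWeakDeriv.smul {j : Fin 2} {u g : TorusL2 a b} (hu : IsWeakDeriv a b j u g) (c : ℂ) :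
    IsWeakDeriv a b j (c • u) (c • g) :=
  (weakDerivGraph a b j).smul_mem (x := (u, g)) c hu

variable (hab : LinearIndependent ℝ ![a, b])

theorem coords_symm_single_mem_lattice (i : Fin 2) :
    (coords a b hab).symm (Pi.single i 1) ∈ lattice a b := by
  rw [coords_symm_apply]
  fin_cases i
  · exact ⟨1, 0, by simp⟩
  · exact ⟨0, 1, by simp⟩

include hab

theorem integral_pderiv_eq_zero {f : Plane → ℂ} (hf : ContDiff ℝ 1 f) (hp : IsPeriodic a b f)
    (j : Fin 2) : ∫ x, pderiv j f x ∂torusMeasure a b = 0 := by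
  let e := (coords a b hab).symm
  have hchain (x : Fin 2 → ℝ) : pderiv j f (e x) =
      fderiv ℝ (f ∘ e) x (coords a b hab (EuclideanSpace.single j 1)) := by
    rw [fderiv_comp x (hf.differentiable one_ne_zero _) e.differentiableAt, e.fderiv]
    simp [e, pderiv]
  rw [← (measurePreserving_coords_symm hab).integral_comp e.toHomeomorph.measurableEmbedding]
  simp_rw [show ∀ x, pderiv j f ((coords a b hab).symm x) = _ from hchain]
  refine setIntegral_Icc_fderiv_eq_zero (hf.comp e.contDiff) (fun i x => ?_) _
  rw [Function.comp_apply, map_add, hp _ (coords_symm_single_mem_lattice hab i),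
    Function.comp_apply]

theorem integral_mul_pderiv {f g : Plane → ℂ} (hf : ContDiff ℝ 1 f) (hg : ContDiff ℝ 1 g)
    (hfp : IsPeriodic a b f) (hgp : IsPeriodic a b g) (j : Fin 2) :
    ∫ x, f x * pderiv j g x ∂torusMeasure a b = - ∫ x, pderiv j f x * g x ∂torusMeasure a b := by
  have h := integral_pderiv_eq_zero hab (hf.mul hg)
    (fun l hl r => by simp only [hfp l hl r, hgp l hl r]) j
  simp_rw [pderiv_mul hf hg j] at h
  rw [integral_add (f := fun x => f x * pderiv j g x) (g := fun x => pderiv j f x * g x)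
    (integrable_of_continuous (hf.continuous.mul (continuous_pderiv hg j)))
    (integrable_of_continuous ((continuous_pderiv hf j).mul hg.continuous))] at h
  exact eq_neg_of_add_eq_zero_left h

theorem isWeakDeriv_toTorusL2 {f : Plane → ℂ} (hf : ContDiff ℝ 1 f) (hp : IsPeriodic a b f)
    (j : Fin 2) :
    IsWeakDeriv a b j (toTorusL2 a b hf.continuous) (toTorusL2 a b (continuous_pderiv hf j)) := by
  intro g hg
  have hcongr {F : Plane → ℂ} (hF : Continuous F) (G : Plane → ℂ) :
      ∫ x, toTorusL2 a b hF x * G x ∂torusMeasure a b = ∫ x, F x * G x ∂torusMeasure a b :=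
    integral_congr_ae ((coeFn_toTorusL2 hF).mul (.refl _ _))
  rw [hcongr, hcongr]
  exact integral_mul_pderiv hab hf (hg.1.of_le (by simp)) hp hg.2 j

theorem IsWeakDeriv.inner_fourierBasis {j : Fin 2} {u g : TorusL2 a b} (h : IsWeakDeriv a b j u g)
    (n : Fin 2 → ℤ) : inner ℂ (fourierBasis hab n) g =
      Complex.I * freq hab n j * inner ℂ (fourierBasis hab n) u := by
  have hwave := h _ (isTorusSmooth_planeWave (neg_mem_dualLattice (freq_mem_dualLattice hab n)))
  rw [BlochFiber.inner_fourierBasis, BlochFiber.inner_fourierBasis, ← neg_eq_iff_eq_neg.2 hwave,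
    ← integral_const_mul, ← integral_neg]
  refine integral_congr_ae (.of_forall fun x => ?_)
  simp only [pderiv_planeWave, PiLp.neg_apply]
  push_cast
  ring

theorem inner_eq_neg_inner_of_inner_fourierBasis {j : Fin 2} {u g v h : TorusL2 a b}
    (hu : ∀ n, inner ℂ (fourierBasis hab n) g =
      Complex.I * freq hab n j * inner ℂ (fourierBasis hab n) u)
    (hv : ∀ n, inner ℂ (fourierBasis hab n) h =
      Complex.I * freq hab n j * inner ℂ (fourierBasis hab n) v) :
    inner ℂ g v = -inner ℂ u h := by
  refine ((fourierBasis hab).hasSum_inner_mul_inner g v).unique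
    (((fourierBasis hab).hasSum_inner_mul_inner u h).neg.congr_fun fun n => ?_)
  rw [hv, ← inner_conj_symm g, ← inner_conj_symm u, hu]
  simp
  ring

/-- Integration by parts is tested here on `C¹` functions rather than smooth ones, since the
components of `A` are only `C¹`. -/
theorem integral_mul_pderiv_of_inner_fourierBasis {j : Fin 2} {u g : TorusL2 a b}
    (h : ∀ n, inner ℂ (fourierBasis hab n) g =
      Complex.I * freq hab n j * inner ℂ (fourierBasis hab n) u)
    {f : Plane → ℂ} (hf : ContDiff ℝ 1 f) (hp : IsPeriodic a b f) :
    ∫ x, u x * pderiv j f x ∂torusMeasure a b = - ∫ x, g x * f x ∂torusMeasure a b := by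
  have hconj := isWeakDeriv_toTorusL2 hab (contDiff_conj hf)
    (fun l hl r => congrArg (starRingEnd ℂ) (hp l hl r)) j
  have hparts := inner_eq_neg_inner_of_inner_fourierBasis hab (hconj.inner_fourierBasis hab) h
  simpa only [inner_toTorusL2, pderiv_conj hf, Complex.conj_conj] using hparts

theorem isWeakDeriv_iff {j : Fin 2} {u g : TorusL2 a b} :
    IsWeakDeriv a b j u g ↔ ∀ n, inner ℂ (fourierBasis hab n) g =
      Complex.I * freq hab n j * inner ℂ (fourierBasis hab n) u :=
  ⟨fun h => h.inner_fourierBasis hab, fun h _ hf =>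
    integral_mul_pderiv_of_inner_fourierBasis hab h (hf.1.of_le (by simp)) hf.2⟩

theorem IsWeakDeriv.inner_left {j : Fin 2} {u g v h : TorusL2 a b} (hu : IsWeakDeriv a b j u g)
    (hv : IsWeakDeriv a b j v h) : inner ℂ g v = -inner ℂ u h :=
  inner_eq_neg_inner_of_inner_fourierBasis hab (hu.inner_fourierBasis hab)
    (hv.inner_fourierBasis hab)

theorem mem_graph_weakDeriv {j : Fin 2} {u g : TorusL2 a b} :
    (u, g) ∈ (weakDeriv a b j).graph ↔ IsWeakDeriv a b j u g := by
  rw [weakDeriv_graph hab]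
  rfl

end WeakDerivative

/-! ### Multiplication operators -/

section Multiplication

variable {a b : Plane}

theorem memLp_top_of_continuous {φ : Plane → ℂ} (hφ : Continuous φ) :
    MemLp φ ⊤ (torusMeasure a b) := by
  obtain ⟨C, hC⟩ := (isCompact_cell a b).exists_bound_of_continuousOn hφ.continuousOn
  exact memLp_top_of_bound hφ.aestronglyMeasurable C
    (ProbabilityTheory.ae_cond_of_forall_mem (isCompact_cell a b).measurableSet hC)

/-- Multiplication by the continuous function `φ` as a bounded operator on `L²(ℝ² / Γ)`. -/
noncomputable def mulContinuous (a b : Plane) {φ : Plane → ℂ} (hφ : Continuous φ) :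
    TorusL2 a b →L[ℂ] TorusL2 a b :=
  (ContinuousLinearMap.mul ℂ ℂ).holderL (torusMeasure a b) ⊤ 2 2 (memLp_top_of_continuous hφ).toLp

theorem coeFn_mulContinuous {φ : Plane → ℂ} (hφ : Continuous φ) (u : TorusL2 a b) :
    mulContinuous a b hφ u =ᵐ[torusMeasure a b] fun x => φ x * u x := by
  filter_upwards [(ContinuousLinearMap.mul ℂ ℂ).coeFn_holder (r := 2)
    ((memLp_top_of_continuous hφ).toLp) u, (memLp_top_of_continuous hφ).coeFn_toLp] with x hx hφx
  rw [← hφx]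
  exact hx

theorem mulContinuous_mulContinuous {φ ψ χ : Plane → ℂ} (hφ : Continuous φ) (hψ : Continuous ψ)
    (hχ : Continuous χ) (h : ∀ x, φ x * ψ x = χ x) (u : TorusL2 a b) :
    mulContinuous a b hφ (mulContinuous a b hψ u) = mulContinuous a b hχ u := by
  apply Lp.ext
  filter_upwards [coeFn_mulContinuous hφ (mulContinuous a b hψ u), coeFn_mulContinuous hψ u,
    coeFn_mulContinuous hχ u] with x hφx hψx hχx
  rw [hφx, hψx, hχx, ← h, mul_assoc]

theorem mulContinuous_comm {φ ψ : Plane → ℂ} (hφ : Continuous φ) (hψ : Continuous ψ)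
    (u : TorusL2 a b) :
    mulContinuous a b hφ (mulContinuous a b hψ u) =
      mulContinuous a b hψ (mulContinuous a b hφ u) := by
  rw [mulContinuous_mulContinuous hφ hψ (hφ.mul hψ) fun _ => rfl,
    mulContinuous_mulContinuous hψ hφ (hφ.mul hψ) fun _ => mul_comm _ _]

theorem mulContinuous_add {φ ψ χ : Plane → ℂ} (hφ : Continuous φ) (hψ : Continuous ψ)
    (hχ : Continuous χ) (h : ∀ x, φ x + ψ x = χ x) (u : TorusL2 a b) :
    mulContinuous a b hφ u + mulContinuous a b hψ u = mulContinuous a b hχ u := by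
  apply Lp.ext
  filter_upwards [coeFn_mulContinuous hφ u, coeFn_mulContinuous hψ u, coeFn_mulContinuous hχ u,
    Lp.coeFn_add (mulContinuous a b hφ u) (mulContinuous a b hψ u)] with x hφx hψx hχx hadd
  rw [hadd, Pi.add_apply, hφx, hψx, hχx, ← h, add_mul]

theorem mulContinuous_const (c : ℂ) (u : TorusL2 a b) :
    mulContinuous a b (continuous_const (y := c)) u = c • u := by
  apply Lp.ext
  filter_upwards [coeFn_mulContinuous (continuous_const (y := c)) u, Lp.coeFn_smul c u]
    with x hx hsmul
  rw [hx, hsmul, Pi.smul_apply, smul_eq_mul]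

theorem integral_mulContinuous_mul {φ : Plane → ℂ} (hφ : Continuous φ) (u : TorusL2 a b)
    (f : Plane → ℂ) : ∫ x, mulContinuous a b hφ u x * f x ∂torusMeasure a b =
      ∫ x, u x * (φ x * f x) ∂torusMeasure a b := by
  refine integral_congr_ae ?_
  filter_upwards [coeFn_mulContinuous hφ u] with x hx
  rw [hx]
  ring

theorem IsWeakDeriv.mulContinuous (hab : LinearIndependent ℝ ![a, b]) {j : Fin 2}
    {u g : TorusL2 a b} (h : IsWeakDeriv a b j u g) {φ : Plane → ℂ} (hφ : ContDiff ℝ 1 φ)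
    (hp : IsPeriodic a b φ) :
    IsWeakDeriv a b j (mulContinuous a b hφ.continuous u)
      (BlochFiber.mulContinuous a b hφ.continuous g +
        BlochFiber.mulContinuous a b (continuous_pderiv hφ j) u) := by
  intro f hf
  have hf₁ : ContDiff ℝ 1 f := hf.1.of_le (by simp)
  have hparts := integral_mul_pderiv_of_inner_fourierBasis hab (h.inner_fourierBasis hab)
    (hφ.mul hf₁) (fun l hl r => by simp only [hp l hl r, hf.2 l hl r])
  simp_rw [pderiv_mul hφ hf₁, mul_add] at hparts
  rw [integral_add (f := fun x => u x * (φ x * pderiv j f x))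
    (g := fun x => u x * (pderiv j φ x * f x))
    (integrable_mul_of_continuous a b u (hφ.continuous.mul (continuous_pderiv hf₁ j)))
    (integrable_mul_of_continuous a b u ((continuous_pderiv hφ j).mul hf₁.continuous))] at hparts
  rw [integral_add_mul a b _ _ hf₁.continuous, integral_mulContinuous_mul,
    integral_mulContinuous_mul, integral_mulContinuous_mul, neg_add]
  linear_combination hparts

theorem mem_graph_mulOp {f : Plane → ℝ} {u v : TorusL2 a b} :
    (u, v) ∈ (mulOp a b f).graph ↔ v =ᵐ[torusMeasure a b] fun x => (f x : ℂ) * u x := by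
  constructor
  · intro h
    obtain ⟨w, rfl, rfl⟩ := (LinearPMap.mem_graph_iff _).1 h
    exact MemLp.coeFn_toLp w.2
  · intro h
    have hu : MemLp (fun x => (f x : ℂ) * u x) 2 (torusMeasure a b) :=
      (memLp_congr_ae h).1 (Lp.memLp v)
    convert (mulOp a b f).mem_graph ⟨u, hu⟩ using 2
    exact Lp.ext (h.trans hu.coeFn_toLp.symm)

theorem isSymmetric_mulOp (f : Plane → ℝ) : IsSymmetric (mulOp a b f) := by
  intro u u' v v' hu hv
  rw [mem_graph_mulOp] at hu hv
  rw [L2.inner_def, L2.inner_def]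
  refine integral_congr_ae ?_
  filter_upwards [hu, hv] with x hux hvx
  simp only [hux, hvx, RCLike.inner_apply, map_mul]
  rw [show starRingEnd ℂ (f x : ℂ) = f x from Complex.conj_ofReal _]
  ring

theorem ae_norm_le_of_hasSum (hab : LinearIndependent ℝ ![a, b]) {u : TorusL2 a b} {S : ℝ}
    (h : HasSum (fun n => ‖inner ℂ (fourierBasis hab n) u‖) S) :
    ∀ᵐ x ∂torusMeasure a b, ‖u x‖ ≤ S := by
  let F (n : Fin 2 → ℤ) : TorusL2 a b := inner ℂ (fourierBasis hab n) u • fourierBasis hab n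
  have hu : ∑' n, F n = u := by
    simpa only [HilbertBasis.repr_apply_apply] using ((fourierBasis hab).hasSum_repr u).tsum_eq
  have hnorm (n) : ∀ᵐ x ∂torusMeasure a b, ‖F n x‖ = ‖inner ℂ (fourierBasis hab n) u‖ := by
    filter_upwards [Lp.coeFn_smul (inner ℂ (fourierBasis hab n) u) (fourierBasis hab n),
      coeFn_toTorusL2 (a := a) (b := b) (continuous_planeWave (freq hab n))] with x hx hwave
    rw [hx, Pi.smul_apply, fourierBasis_apply, hwave, norm_smul, norm_planeWave, mul_one]
  have hsum := Lp.hasSum_coeFn_tsum (p := 2) (f := F) (μ := torusMeasure a b) (by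
    simp_rw [F, ← ofReal_norm, norm_smul, (fourierBasis hab).orthonormal.1, mul_one]
    exact h.summable.tsum_ofReal_ne_top)
  rw [hu] at hsum
  filter_upwards [hsum, ae_all_iff.2 hnorm] with x hx hFx
  rw [← hx.tsum_eq]
  exact tsum_of_norm_bounded h fun n => (hFx n).le

end Multiplication

/-! ### The free resolvent -/

section FreeResolvent

variable {a b : Plane} (hab : LinearIndependent ℝ ![a, b])

/-- The symbol `|ξ|² / 2` of `-Δ / 2` at the frequencies of the Fourier basis. -/
noncomputable def kineticSymbol (n : Fin 2 → ℤ) : ℝ := ‖freq hab n‖ ^ 2 / 2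

theorem kineticSymbol_nonneg (n : Fin 2 → ℤ) : 0 ≤ kineticSymbol hab n := by
  unfold kineticSymbol
  positivity

theorem kineticSymbol_eq_sum (n : Fin 2 → ℤ) :
    kineticSymbol hab n = (freq hab n 0 ^ 2 + freq hab n 1 ^ 2) / 2 := by
  rw [kineticSymbol, EuclideanSpace.norm_sq_eq]
  simp

theorem freq_sq_le (n : Fin 2 → ℤ) (j : Fin 2) : freq hab n j ^ 2 ≤ 2 * kineticSymbol hab n := by
  rw [kineticSymbol, mul_div_cancel₀ _ two_ne_zero, EuclideanSpace.norm_sq_eq]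
  simpa using Finset.single_le_sum (f := fun i => ‖freq hab n i‖ ^ 2)
    (fun i _ => sq_nonneg _) (Finset.mem_univ j)

theorem exists_mul_sq_le_kineticSymbol :
    ∃ c > 0, ∀ n i, c * (n i : ℝ) ^ 2 ≤ kineticSymbol hab n := by
  let v (i : Fin 2) : Plane := (coords a b hab).symm (Pi.single i 1)
  set C : ℝ := 1 + ∑ i, ‖v i‖ ^ 2
  have : 0 < C := by positivity
  refine ⟨1 / (2 * C), by positivity, fun n i => ?_⟩
  have hcoord : inner ℝ (freq hab n) (v i) = 2 * Real.pi * n i := by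
    simp [v, inner_freq, Pi.single_apply]
  have hv : ‖v i‖ ^ 2 ≤ C := by
    have := Finset.single_le_sum (f := fun i => ‖v i‖ ^ 2) (fun i _ => sq_nonneg _)
      (Finset.mem_univ i)
    linarith
  have hsq : (n i : ℝ) ^ 2 ≤ ‖freq hab n‖ ^ 2 * C :=
    calc (n i : ℝ) ^ 2
      _ ≤ (2 * Real.pi) ^ 2 * (n i : ℝ) ^ 2 :=
        le_mul_of_one_le_left (sq_nonneg _) (by nlinarith [Real.pi_gt_three])
      _ = |inner ℝ (freq hab n) (v i)| ^ 2 := by rw [hcoord, sq_abs]; ring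
      _ ≤ (‖freq hab n‖ * ‖v i‖) ^ 2 := by gcongr; exact abs_real_inner_le_norm _ _
      _ ≤ ‖freq hab n‖ ^ 2 * C := by rw [mul_pow]; gcongr
  rw [kineticSymbol, div_mul_eq_mul_div, one_mul, div_le_div_iff₀ (by positivity) two_pos]
  linarith

theorem summable_inv_kineticSymbol_sq {l : ℝ} (hl : 0 < l) :
    Summable fun n => (kineticSymbol hab n + l)⁻¹ ^ 2 := by
  obtain ⟨c, hc, hcn⟩ := exists_mul_sq_le_kineticSymbol hab
  have hone := summable_inv_mul_sq_add hc hl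
  have hprod : Summable fun n : Fin 2 → ℤ =>
      (c * (n 0 : ℝ) ^ 2 + l)⁻¹ * (c * (n 1 : ℝ) ^ 2 + l)⁻¹ :=
    (finTwoArrowEquiv ℤ).summable_iff.2
      (hone.mul_of_nonneg hone (fun n => by positivity) (fun n => by positivity))
  refine hprod.of_nonneg_of_le (fun n => sq_nonneg _) fun n => ?_
  have hle (i : Fin 2) : (kineticSymbol hab n + l)⁻¹ ≤ (c * (n i : ℝ) ^ 2 + l)⁻¹ := by
    have := hcn n i
    gcongr
  have hn := kineticSymbol_nonneg hab n
  rw [sq]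
  exact mul_le_mul (hle 0) (hle 1) (by positivity) (by positivity)

theorem tendsto_tsum_inv_kineticSymbol_sq :
    Tendsto (fun l => ∑' n, (kineticSymbol hab n + l)⁻¹ ^ 2) atTop (𝓝 0) := by
  rw [← tsum_zero (α := ℝ) (β := Fin 2 → ℤ)]
  refine tendsto_tsum_of_dominated_convergence (summable_inv_kineticSymbol_sq hab one_pos)
    (fun n => ?_) ?_
  · simpa using (tendsto_atTop_add_const_left atTop (kineticSymbol hab n)
      tendsto_id).inv_tendsto_atTop.pow 2
  · filter_upwards [eventually_ge_atTop 1] with l hl n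
    have hn := kineticSymbol_nonneg hab n
    rw [Real.norm_of_nonneg (by positivity)]
    gcongr

theorem isWeakDeriv_diagonalOperator {m : (Fin 2 → ℤ) → ℂ} {C C' : ℝ} {j : Fin 2}
    (hm : ∀ n, ‖m n‖ ≤ C) (hm' : ∀ n, ‖Complex.I * freq hab n j * m n‖ ≤ C') (f : TorusL2 a b) :
    IsWeakDeriv a b j (diagonalOperator (fourierBasis hab) m f)
      (diagonalOperator (fourierBasis hab) (fun n => Complex.I * freq hab n j * m n) f) := by
  refine (isWeakDeriv_iff hab).2 fun n => ?_
  rw [inner_diagonalOperator _ hm, inner_diagonalOperator _ hm', mul_assoc]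

/-- The free resolvent `(-Δ / 2 + l)⁻¹`. -/
noncomputable def freeResolvent (l : ℝ) : TorusL2 a b →L[ℂ] TorusL2 a b :=
  diagonalOperator (fourierBasis hab) fun n => ((kineticSymbol hab n + l : ℝ) : ℂ)⁻¹

/-- The operator `∂_j (-Δ / 2 + l)⁻¹`. -/
noncomputable def derivFreeResolvent (l : ℝ) (j : Fin 2) : TorusL2 a b →L[ℂ] TorusL2 a b :=
  diagonalOperator (fourierBasis hab) fun n =>
    Complex.I * freq hab n j * ((kineticSymbol hab n + l : ℝ) : ℂ)⁻¹

/-- The operator `∂_i ∂_j (-Δ / 2 + l)⁻¹`. -/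
noncomputable def derivTwoFreeResolvent (l : ℝ) (i j : Fin 2) : TorusL2 a b →L[ℂ] TorusL2 a b :=
  diagonalOperator (fourierBasis hab) fun n =>
    Complex.I * freq hab n i * (Complex.I * freq hab n j * ((kineticSymbol hab n + l : ℝ) : ℂ)⁻¹)

theorem inner_neg_half_laplacian {u : TorusL2 a b} {d d' : Fin 2 → TorusL2 a b}
    (hd : ∀ j, IsWeakDeriv a b j u (d j)) (hd' : ∀ j, IsWeakDeriv a b j (d j) (d' j))
    (n : Fin 2 → ℤ) : inner ℂ (fourierBasis hab n) ((-(1 / 2 : ℂ)) • (d' 0 + d' 1)) =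
      kineticSymbol hab n * inner ℂ (fourierBasis hab n) u := by
  rw [inner_smul_right, inner_add_right, (hd' 0).inner_fourierBasis hab,
    (hd' 1).inner_fourierBasis hab, (hd 0).inner_fourierBasis hab, (hd 1).inner_fourierBasis hab,
    kineticSymbol_eq_sum]
  push_cast
  linear_combination (-(1 / 2 : ℂ)) * ((freq hab n 0 : ℂ) ^ 2 + (freq hab n 1 : ℂ) ^ 2) *
    inner ℂ (fourierBasis hab n) u * Complex.I_sq

section

variable {l : ℝ} (hl : 0 < l)

include hl

theorem kineticSymbol_add_pos (n : Fin 2 → ℤ) : 0 < kineticSymbol hab n + l :=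
  add_pos_of_nonneg_of_pos (kineticSymbol_nonneg hab n) hl

theorem norm_inv_kineticSymbol_add (n : Fin 2 → ℤ) :
    ‖((kineticSymbol hab n + l : ℝ) : ℂ)⁻¹‖ = (kineticSymbol hab n + l)⁻¹ := by
  rw [norm_inv, Complex.norm_of_nonneg (kineticSymbol_add_pos hab hl n).le]

theorem norm_inv_kineticSymbol_add_le (n : Fin 2 → ℤ) :
    ‖((kineticSymbol hab n + l : ℝ) : ℂ)⁻¹‖ ≤ l⁻¹ := by
  rw [norm_inv_kineticSymbol_add hab hl]
  exact inv_anti₀ hl (le_add_of_nonneg_left (kineticSymbol_nonneg hab n))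

theorem norm_freq_mul_inv_kineticSymbol_add_le (j : Fin 2) (n : Fin 2 → ℤ) :
    ‖Complex.I * freq hab n j * ((kineticSymbol hab n + l : ℝ) : ℂ)⁻¹‖ ≤ (√l)⁻¹ := by
  rw [norm_mul, norm_mul, Complex.norm_I, one_mul, Complex.norm_real,
    norm_inv_kineticSymbol_add hab hl, ← div_eq_mul_inv,
    div_le_iff₀ (kineticSymbol_add_pos hab hl n), ← div_eq_inv_mul,
    le_div_iff₀ (Real.sqrt_pos.2 hl), Real.norm_eq_abs]
  nlinarith [freq_sq_le hab n j, sq_abs (freq hab n j), Real.sq_sqrt hl.le,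
    sq_nonneg (|freq hab n j| - √l)]

theorem norm_freq_mul_freq_mul_inv_kineticSymbol_add_le (i j : Fin 2) (n : Fin 2 → ℤ) :
    ‖Complex.I * freq hab n i *
      (Complex.I * freq hab n j * ((kineticSymbol hab n + l : ℝ) : ℂ)⁻¹)‖ ≤ 2 := by
  simp only [norm_mul, Complex.norm_I, one_mul, Complex.norm_real,
    norm_inv_kineticSymbol_add hab hl]
  rw [← mul_assoc, ← div_eq_mul_inv, div_le_iff₀ (kineticSymbol_add_pos hab hl n),
    Real.norm_eq_abs, Real.norm_eq_abs]
  nlinarith [freq_sq_le hab n i, freq_sq_le hab n j, sq_abs (freq hab n i), sq_abs (freq hab n j),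
    sq_nonneg (|freq hab n i| - |freq hab n j|)]

theorem inner_freeResolvent (f : TorusL2 a b) (n : Fin 2 → ℤ) :
    inner ℂ (fourierBasis hab n) (freeResolvent hab l f) =
      ((kineticSymbol hab n + l : ℝ) : ℂ)⁻¹ * inner ℂ (fourierBasis hab n) f :=
  inner_diagonalOperator _ (norm_inv_kineticSymbol_add_le hab hl) f n

theorem isWeakDeriv_freeResolvent (j : Fin 2) (f : TorusL2 a b) :
    IsWeakDeriv a b j (freeResolvent hab l f) (derivFreeResolvent hab l j f) :=
  isWeakDeriv_diagonalOperator hab (norm_inv_kineticSymbol_add_le hab hl)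
    (norm_freq_mul_inv_kineticSymbol_add_le hab hl j) f

theorem isWeakDeriv_derivFreeResolvent (i j : Fin 2) (f : TorusL2 a b) :
    IsWeakDeriv a b i (derivFreeResolvent hab l j f) (derivTwoFreeResolvent hab l i j f) :=
  isWeakDeriv_diagonalOperator hab (norm_freq_mul_inv_kineticSymbol_add_le hab hl j)
    (norm_freq_mul_freq_mul_inv_kineticSymbol_add_le hab hl i j) f

theorem norm_freeResolvent_le : ‖freeResolvent hab l‖ ≤ l⁻¹ :=
  norm_diagonalOperator_le _ (inv_pos.2 hl).le (norm_inv_kineticSymbol_add_le hab hl)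

theorem norm_derivFreeResolvent_le (j : Fin 2) : ‖derivFreeResolvent hab l j‖ ≤ (√l)⁻¹ :=
  norm_diagonalOperator_le _ (by positivity) (norm_freq_mul_inv_kineticSymbol_add_le hab hl j)

theorem isCompactOperator_freeResolvent : IsCompactOperator (freeResolvent hab l) := by
  refine isCompactOperator_diagonalOperator _ (norm_inv_kineticSymbol_add_le hab hl) ?_
  rw [tendsto_zero_iff_norm_tendsto_zero]
  simp_rw [norm_inv_kineticSymbol_add hab hl]
  have hsqrt := (summable_inv_kineticSymbol_sq hab hl).tendsto_cofinite_zero.sqrt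
  rw [Real.sqrt_zero] at hsqrt
  exact hsqrt.congr fun n => Real.sqrt_sq (inv_pos.2 (kineticSymbol_add_pos hab hl n)).le

theorem freeResolvent_eq {u : TorusL2 a b} {d d' : Fin 2 → TorusL2 a b}
    (hd : ∀ j, IsWeakDeriv a b j u (d j)) (hd' : ∀ j, IsWeakDeriv a b j (d j) (d' j)) :
    freeResolvent hab l ((-(1 / 2 : ℂ)) • (d' 0 + d' 1) + (l : ℂ) • u) = u := by
  refine eq_of_forall_inner_eq (fourierBasis hab) fun n => ?_
  rw [inner_freeResolvent hab hl, inner_add_right, inner_neg_half_laplacian hab hd hd',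
    inner_smul_right, ← add_mul, ← Complex.ofReal_add, inv_mul_cancel_left₀]
  exact_mod_cast (kineticSymbol_add_pos hab hl n).ne'

theorem neg_half_laplacian_freeResolvent_add (f : TorusL2 a b) :
    (-(1 / 2 : ℂ)) • (derivTwoFreeResolvent hab l 0 0 f + derivTwoFreeResolvent hab l 1 1 f) +
      (l : ℂ) • freeResolvent hab l f = f := by
  refine eq_of_forall_inner_eq (fourierBasis hab) fun n => ?_
  rw [inner_add_right, inner_neg_half_laplacian hab (isWeakDeriv_freeResolvent hab hl · f)
    (fun j => isWeakDeriv_derivFreeResolvent hab hl j j f), inner_smul_right, ← add_mul,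
    ← Complex.ofReal_add, inner_freeResolvent hab hl, mul_inv_cancel_left₀]
  exact_mod_cast ne_of_gt (kineticSymbol_add_pos hab hl n)

/-- This is where the dimension enters: `|ξ|⁻²` is square summable at infinity over a lattice of
rank two. -/
theorem ae_norm_freeResolvent_le (f : TorusL2 a b) :
    ∀ᵐ x ∂torusMeasure a b, ‖freeResolvent hab l f x‖ ≤
      √(∑' n, (kineticSymbol hab n + l)⁻¹ ^ 2) * ‖f‖ := by
  have hpos (n) : 0 ≤ (kineticSymbol hab n + l)⁻¹ := (inv_pos.2 (kineticSymbol_add_pos hab hl n)).le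
  have htsum : 0 ≤ ∑' n, (kineticSymbol hab n + l)⁻¹ ^ 2 := tsum_nonneg fun n => sq_nonneg _
  obtain ⟨S, -, hS, hsum⟩ := Real.inner_le_Lp_mul_Lq_hasSum_of_nonneg
    (p := 2) (q := 2) (by constructor <;> norm_num)
    (A := √(∑' n, (kineticSymbol hab n + l)⁻¹ ^ 2)) (B := ‖f‖)
    (f := fun n => (kineticSymbol hab n + l)⁻¹) (g := fun n => ‖inner ℂ (fourierBasis hab n) f‖)
    (by positivity) (norm_nonneg _) hpos (fun n => norm_nonneg _)
    (by simpa only [Real.rpow_two, Real.sq_sqrt htsum] using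
      (summable_inv_kineticSymbol_sq hab hl).hasSum)
    (by simpa using hasSum_norm_inner_sq (fourierBasis hab) f)
  have hcoeff : HasSum (fun n => ‖inner ℂ (fourierBasis hab n) (freeResolvent hab l f)‖) S :=
    hsum.congr_fun fun n => by
      rw [inner_freeResolvent hab hl, norm_mul, norm_inv_kineticSymbol_add hab hl]
  filter_upwards [ae_norm_le_of_hasSum hab hcoeff] with x hx
  exact hx.trans hS

end

theorem tendsto_freeResolvent : Tendsto (freeResolvent hab) atTop (𝓝 0) := by
  refine squeeze_zero_norm' ?_ tendsto_inv_atTop_zero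
  filter_upwards [eventually_gt_atTop 0] with l hl using norm_freeResolvent_le hab hl

theorem tendsto_derivFreeResolvent (j : Fin 2) :
    Tendsto (derivFreeResolvent hab · j) atTop (𝓝 0) := by
  refine squeeze_zero_norm' ?_ Real.tendsto_sqrt_atTop.inv_tendsto_atTop
  filter_upwards [eventually_gt_atTop 0] with l hl using norm_derivFreeResolvent_le hab hl j

theorem exists_mul_freeResolvent {V : Plane → ℝ} (hV : MemLp V 2 (torusMeasure a b)) :
    ∃ G : ℝ → TorusL2 a b →L[ℂ] TorusL2 a b,
      (∀ l > 0, ∀ f, G l f =ᵐ[torusMeasure a b] fun x => (V x : ℂ) * freeResolvent hab l f x) ∧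
        Tendsto G atTop (𝓝 0) := by
  choose! G hG hGnorm using fun (l : ℝ) (hl : 0 < l) => exists_mul_clm_of_ae_norm_le
    (freeResolvent hab l) (Real.sqrt_nonneg _) (ae_norm_freeResolvent_le hab hl) hV.ofReal.toLp
  refine ⟨G, fun l hl f => ?_, ?_⟩
  · filter_upwards [hG l hl f, (hV.ofReal (K := ℂ)).coeFn_toLp] with x hx hVx
    rw [hx, hVx]
    rfl
  · have hlim := (tendsto_tsum_inv_kineticSymbol_sq hab).sqrt.mul_const
      ‖(hV.ofReal (K := ℂ)).toLp‖
    rw [Real.sqrt_zero, zero_mul] at hlim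
    refine squeeze_zero_norm' ?_ hlim
    filter_upwards [eventually_gt_atTop 0] with l hl using hGnorm l hl

end FreeResolvent

/-! ### The fiber operators -/

section FiberOperator

variable {a b : Plane} {A : Plane → Plane} {V : Plane → ℝ}

/-- The component `k_j - A_j` as a complex function. -/
noncomputable def shiftedPotential (A : Plane → Plane) (k : Plane) (j : Fin 2) (x : Plane) : ℂ :=
  ((k j - A x j : ℝ) : ℂ)

theorem WeakAssumption.contDiff_shiftedPotential (hAV : WeakAssumption a b A V) (k : Plane)
    (j : Fin 2) : ContDiff ℝ 1 (shiftedPotential A k j) :=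
  Complex.ofRealCLM.contDiff.comp (contDiff_const.sub (hAV.contDiff_A j))

theorem WeakAssumption.isPeriodic_shiftedPotential (hAV : WeakAssumption a b A V) (k : Plane)
    (j : Fin 2) : IsPeriodic a b (shiftedPotential A k j) := fun l hl r => by
  rw [shiftedPotential, shiftedPotential, hAV.periodic_A l hl r]

theorem WeakAssumption.memLp_torusMeasure (hAV : WeakAssumption a b A V) :
    MemLp V 2 (torusMeasure a b) := by
  rw [torusMeasure, ProbabilityTheory.cond]
  by_cases h : volume (cell a b) = 0
  · rw [Measure.restrict_eq_zero.2 h, smul_zero]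
    exact memLp_measure_zero
  · exact hAV.memLp_V.smul_measure (ENNReal.inv_ne_top.2 h)

theorem mem_graph_fiberHamiltonian {k : Plane} {u y : TorusL2 a b} :
    (u, y) ∈ (fiberHamiltonian a b A V k).graph ↔
      ∃ (p q : Fin 2 → TorusL2 a b) (v : TorusL2 a b),
        (∀ j, (u, p j) ∈ (kineticMomentum a b A k j).graph ∧
          (p j, q j) ∈ (kineticMomentum a b A k j).graph) ∧
        (v =ᵐ[torusMeasure a b] fun x => (V x : ℂ) * u x) ∧
        (1 / 2 : ℂ) • (q 0 + q 1) + v = y := by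
  rw [fiberHamiltonian, mem_graph_add]
  constructor
  · rintro ⟨x, v, hx, hv, rfl⟩
    obtain ⟨z, hz, rfl⟩ := mem_graph_smul.1 hx
    obtain ⟨q₀, q₁, hq₀, hq₁, rfl⟩ := mem_graph_add.1 hz
    obtain ⟨p₀, hp₀⟩ := mem_graph_comp.1 hq₀
    obtain ⟨p₁, hp₁⟩ := mem_graph_comp.1 hq₁
    exact ⟨![p₀, p₁], ![q₀, q₁], v, Fin.forall_fin_two.2 ⟨hp₀, hp₁⟩, mem_graph_mulOp.1 hv, rfl⟩
  · rintro ⟨p, q, v, hpq, hv, rfl⟩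
    exact ⟨_, v, mem_graph_smul.2 ⟨_, mem_graph_add.2 ⟨q 0, q 1, mem_graph_comp.2 ⟨p 0, hpq 0⟩,
      mem_graph_comp.2 ⟨p 1, hpq 1⟩, rfl⟩, rfl⟩, mem_graph_mulOp.2 hv, rfl⟩

section

variable (hab : LinearIndependent ℝ ![a, b])
include hab

theorem isSymmetric_kineticMomentum (k : Plane) (j : Fin 2) :
    IsSymmetric (kineticMomentum a b A k j) := by
  refine IsSymmetric.add ?_ (isSymmetric_mulOp _)
  intro u u' v v' hu hv
  obtain ⟨d, hd, rfl⟩ := mem_graph_smul.1 hu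
  obtain ⟨d', hd', rfl⟩ := mem_graph_smul.1 hv
  rw [mem_graph_weakDeriv hab] at hd hd'
  rw [inner_smul_left, inner_smul_right, hd.inner_left hab hd', map_neg, Complex.conj_I]
  ring

theorem isSymmetric_fiberHamiltonian (k : Plane) : IsSymmetric (fiberHamiltonian a b A V k) := by
  refine (IsSymmetric.smul ?_ (by simp only [map_div₀, map_one, map_ofNat])).add
    (isSymmetric_mulOp V)
  exact (isSymmetric_kineticMomentum hab k 0).comp_self.add
    (isSymmetric_kineticMomentum hab k 1).comp_self

end

section

variable (hab : LinearIndependent ℝ ![a, b]) (hAV : WeakAssumption a b A V)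

/-- Multiplication by `k_j - A_j`. -/
noncomputable def mulShift (k : Plane) (j : Fin 2) : TorusL2 a b →L[ℂ] TorusL2 a b :=
  mulContinuous a b (hAV.contDiff_shiftedPotential k j).continuous

/-- Multiplication by `∂_j (k_j - A_j)`. -/
noncomputable def mulDerivShift (k : Plane) (j : Fin 2) : TorusL2 a b →L[ℂ] TorusL2 a b :=
  mulContinuous a b (continuous_pderiv (hAV.contDiff_shiftedPotential k j) j)

include hab in
theorem IsWeakDeriv.mulShift {j : Fin 2} {u d : TorusL2 a b} (h : IsWeakDeriv a b j u d)
    (k : Plane) : IsWeakDeriv a b j (mulShift hAV k j u)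
      (BlochFiber.mulShift hAV k j d + mulDerivShift hAV k j u) :=
  h.mulContinuous hab (hAV.contDiff_shiftedPotential k j) (hAV.isPeriodic_shiftedPotential k j)

include hab in
theorem mem_graph_kineticMomentum {k : Plane} {j : Fin 2} {u p : TorusL2 a b} :
    (u, p) ∈ (kineticMomentum a b A k j).graph ↔
      ∃ d, IsWeakDeriv a b j u d ∧ (-Complex.I) • d + mulShift hAV k j u = p := by
  have hmul (u v : TorusL2 a b) : (u, v) ∈ (mulOp a b fun x => k j - A x j).graph ↔
      mulShift hAV k j u = v := by
    rw [mem_graph_mulOp, eq_comm, Lp.ext_iff]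
    have hcoe := coeFn_mulContinuous (hAV.contDiff_shiftedPotential k j).continuous u
    exact ⟨fun h => h.trans hcoe.symm, fun h => h.trans hcoe⟩
  simp only [kineticMomentum, mem_graph_add, mem_graph_smul, mem_graph_weakDeriv hab, hmul]
  constructor
  · rintro ⟨_, _, ⟨d, hd, rfl⟩, rfl, rfl⟩
    exact ⟨d, hd, rfl⟩
  · rintro ⟨d, hd, rfl⟩
    exact ⟨_, _, ⟨d, hd, rfl⟩, rfl, rfl⟩

include hab hAV in
theorem exists_isWeakDeriv_of_mem_graph {k : Plane} {j : Fin 2} {u p q : TorusL2 a b}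
    (h : (u, p) ∈ (kineticMomentum a b A k j).graph)
    (h' : (p, q) ∈ (kineticMomentum a b A k j).graph) :
    ∃ d d', IsWeakDeriv a b j u d ∧ IsWeakDeriv a b j d d' := by
  obtain ⟨d, hd, rfl⟩ := (mem_graph_kineticMomentum hab hAV).1 h
  obtain ⟨d', hd', -⟩ := (mem_graph_kineticMomentum hab hAV).1 h'
  have hd_eq : d = Complex.I •
      ((-Complex.I) • d + mulShift hAV k j u + (-1 : ℂ) • mulShift hAV k j u) := by
    rw [neg_one_smul, add_neg_cancel_right, smul_smul, mul_neg, Complex.I_mul_I, neg_neg, one_smul]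
  have hdd := (hd'.add ((hd.mulShift hab hAV k).smul (-1))).smul Complex.I
  rw [← hd_eq] at hdd
  exact ⟨d, _, hd, hdd⟩

/-- The relative perturbation `½ ((-i ∂_j + k_j - A_j)² + ∂_j²) (-Δ / 2 + l)⁻¹`. -/
noncomputable def momentumPerturbation (k : Plane) (l : ℝ) (j : Fin 2) :
    TorusL2 a b →L[ℂ] TorusL2 a b :=
  (-Complex.I) • (mulShift hAV k j ∘L derivFreeResolvent hab l j) +
    (-(Complex.I / 2)) • (mulDerivShift hAV k j ∘L freeResolvent hab l) +
    (1 / 2 : ℂ) • (mulShift hAV k j ∘L mulShift hAV k j ∘L freeResolvent hab l)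

theorem tendsto_momentumPerturbation (k : Plane) (j : Fin 2) :
    Tendsto (momentumPerturbation hab hAV k · j) atTop (𝓝 0) := by
  have hcomp (W : TorusL2 a b →L[ℂ] TorusL2 a b) {R : ℝ → TorusL2 a b →L[ℂ] TorusL2 a b}
      (hR : Tendsto R atTop (𝓝 0)) : Tendsto (fun l => W ∘L R l) atTop (𝓝 0) := by
    exact ((ContinuousLinearMap.compL ℂ _ _ _ W).continuous.tendsto' 0 0 (map_zero _)).comp hR
  have hR := tendsto_freeResolvent hab
  simpa only [momentumPerturbation, smul_zero, add_zero] using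
    (((hcomp (mulShift hAV k j) (tendsto_derivFreeResolvent hab j)).const_smul (-Complex.I)).add
      ((hcomp (mulDerivShift hAV k j) hR).const_smul (-(Complex.I / 2)))).add
      ((hcomp (mulShift hAV k j) (hcomp (mulShift hAV k j) hR)).const_smul (1 / 2 : ℂ))

theorem exists_kineticMomentum_sq_freeResolvent (k : Plane) {l : ℝ} (hl : 0 < l) (j : Fin 2)
    (f : TorusL2 a b) : ∃ p q,
      (freeResolvent hab l f, p) ∈ (kineticMomentum a b A k j).graph ∧
      (p, q) ∈ (kineticMomentum a b A k j).graph ∧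
      (1 / 2 : ℂ) • q = (-(1 / 2 : ℂ)) • derivTwoFreeResolvent hab l j j f +
        momentumPerturbation hab hAV k l j f := by
  have hd := isWeakDeriv_freeResolvent hab hl j f
  have hd' := isWeakDeriv_derivFreeResolvent hab hl j j f
  refine ⟨_, _, (mem_graph_kineticMomentum hab hAV).2 ⟨_, hd, rfl⟩,
    (mem_graph_kineticMomentum hab hAV).2
      ⟨_, (hd'.smul (-Complex.I)).add (hd.mulShift hab hAV k), rfl⟩, ?_⟩
  simp only [momentumPerturbation, map_add, map_smul, add_apply, smul_apply,
    ContinuousLinearMap.comp_apply]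
  match_scalars
  · linear_combination (1 / 2 : ℂ) * Complex.I_sq
  all_goals ring

include hAV in
/-- In operator form, `(H(k) + l) (-Δ / 2 + l)⁻¹ = 1 + K l`. -/
theorem exists_mem_graph_freeResolvent (k : Plane) :
    ∃ K : ℝ → TorusL2 a b →L[ℂ] TorusL2 a b, Tendsto K atTop (𝓝 0) ∧ ∀ l > 0, ∀ f,
      (freeResolvent hab l f, f + K l f + (-l : ℂ) • freeResolvent hab l f) ∈
        (fiberHamiltonian a b A V k).graph := by
  obtain ⟨G, hG, hG_lim⟩ := exists_mul_freeResolvent hab hAV.memLp_torusMeasure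
  refine ⟨fun l => momentumPerturbation hab hAV k l 0 + momentumPerturbation hab hAV k l 1 + G l,
    ?_, fun l hl f => ?_⟩
  · simpa only [add_zero] using ((tendsto_momentumPerturbation hab hAV k 0).add
      (tendsto_momentumPerturbation hab hAV k 1)).add hG_lim
  · choose p q hp hq hpq using fun j => exists_kineticMomentum_sq_freeResolvent hab hAV k hl j f
    refine mem_graph_fiberHamiltonian.2 ⟨p, q, G l f, fun j => ⟨hp j, hq j⟩, hG l hl f, ?_⟩
    have hfree := neg_half_laplacian_freeResolvent_add hab hl f
    rw [smul_add, hpq, hpq, add_apply, add_apply]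
    linear_combination (norm := module) hfree

end

end FiberOperator

/-! ### Domain and resolvent of the fiber operators -/

section Spectrum

variable {a b : Plane} {A : Plane → Plane} {V : Plane → ℝ} (hab : LinearIndependent ℝ ![a, b])

section

variable (hAV : WeakAssumption a b A V)
include hAV

theorem exists_freeResolvent_eq_of_mem_graph {k : Plane} {u y : TorusL2 a b}
    (h : (u, y) ∈ (fiberHamiltonian a b A V k).graph) {l : ℝ} (hl : 0 < l) :
    ∃ f, freeResolvent hab l f = u := by
  obtain ⟨p, q, v, hpq, -, -⟩ := mem_graph_fiberHamiltonian.1 h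
  choose d d' hd hd' using fun j =>
    exists_isWeakDeriv_of_mem_graph hab hAV (hpq j).1 (hpq j).2
  exact ⟨_, freeResolvent_eq hab hl hd hd'⟩

include hab in
theorem domain_fiberHamiltonian (k : Plane) :
    ((fiberHamiltonian a b A V k).domain : Set (TorusL2 a b)) = sobolevTwo a b := by
  ext u
  constructor
  · intro hu
    obtain ⟨f, rfl⟩ := exists_freeResolvent_eq_of_mem_graph hab hAV
      ((fiberHamiltonian a b A V k).mem_graph ⟨u, hu⟩) one_pos
    exact fun i => ⟨_, isWeakDeriv_freeResolvent hab one_pos i f, fun j =>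
      ⟨_, isWeakDeriv_derivFreeResolvent hab one_pos j i f⟩⟩
  · intro hu
    choose d hd d' hd' using hu
    obtain ⟨K, -, hK⟩ := exists_mem_graph_freeResolvent hab hAV k
    rw [← freeResolvent_eq hab one_pos hd fun j => hd' j j]
    exact LinearPMap.mem_domain_of_mem_graph (hK 1 one_pos _)

end

/-- The free resolvent inverts `H(k) + l` up to a relative error of norm at most `1 / 2`:
`(H(k) + l) (-Δ / 2 + l)⁻¹ = 1 + K` with `‖K‖ ≤ 1 / 2`. -/
def IsFreeParametrix (A : Plane → Plane) (V : Plane → ℝ) (k : Plane) (l : ℝ) : Prop :=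
  0 < l ∧ ∃ K : TorusL2 a b →L[ℂ] TorusL2 a b, ‖K‖ ≤ 1 / 2 ∧ ∀ f,
    (freeResolvent hab l f, f + K f + (-l : ℂ) • freeResolvent hab l f) ∈
      (fiberHamiltonian a b A V k).graph

theorem eventually_isFreeParametrix (hAV : WeakAssumption a b A V) (k : Plane) :
    ∀ᶠ l in atTop, IsFreeParametrix hab A V k l := by
  obtain ⟨K, hK, hKgraph⟩ := exists_mem_graph_freeResolvent hab hAV k
  have hsmall : ∀ᶠ l in atTop, ‖K l‖ < 1 / 2 :=
    hK.norm.eventually_lt_const (by rw [norm_zero]; exact one_half_pos)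
  filter_upwards [eventually_gt_atTop 0, hsmall] with l hl hl'
  exact ⟨hl, K l, hl'.le, hKgraph l hl⟩

section

variable {hab} (hAV : WeakAssumption a b A V) {k : Plane} {l : ℝ}
include hAV

theorem IsFreeParametrix.exists_isResolventAt (h : IsFreeParametrix hab A V k l) :
    ∃ R, IsResolventAt (fiberHamiltonian a b A V k) (-l : ℝ) R ∧ IsCompactOperator R := by
  obtain ⟨hl, K, hK, hgraph⟩ := h
  refine exists_isResolventAt_of_norm_lt_one (isCompactOperator_freeResolvent hab hl)
    (hK.trans_lt one_half_lt_one) (fun u hu => ?_) fun f => ?_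
  · exact exists_freeResolvent_eq_of_mem_graph hab hAV
      ((fiberHamiltonian a b A V k).mem_graph ⟨u, hu⟩) hl
  · rw [Complex.ofReal_neg]
    exact hgraph f

theorem IsFreeParametrix.eigenspace_eq_bot (h : IsFreeParametrix hab A V k l) :
    eigenspace (fiberHamiltonian a b A V k) (-l : ℝ) = ⊥ := by
  obtain ⟨R, hR, -⟩ := h.exists_isResolventAt hAV
  exact hR.eigenspace_eq_bot

theorem IsFreeParametrix.exists_norm_le (h : IsFreeParametrix hab A V k l) {u y : TorusL2 a b}
    (hu : (u, y) ∈ (fiberHamiltonian a b A V k).graph) :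
    ∃ f, freeResolvent hab l f = u ∧ ‖f‖ ≤ 2 * ‖y + (l : ℂ) • u‖ := by
  obtain ⟨hl, K, hK, hgraph⟩ := h
  obtain ⟨f, rfl⟩ := exists_freeResolvent_eq_of_mem_graph hab hAV hu hl
  obtain rfl := (fiberHamiltonian a b A V k).mem_graph_snd_inj hu (hgraph f) rfl
  refine ⟨f, rfl, ?_⟩
  have hKf : ‖K f‖ ≤ 1 / 2 * ‖f‖ := K.le_of_opNorm_le hK f
  have hf : ‖f‖ - ‖K f‖ ≤ ‖f + K f‖ := norm_sub_le_norm_add f (K f)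
  rw [add_assoc, ← add_smul, neg_add_cancel, zero_smul, add_zero]
  linarith

variable {l₀ : ℝ} (h : ∀ l ≥ l₀, IsFreeParametrix hab A V k l)
include h

theorem eigenspace_eq_bot_of_le {c : ℝ} (hc : c ≤ -l₀) :
    eigenspace (fiberHamiltonian a b A V k) c = ⊥ := by
  simpa only [neg_neg] using (h (-c) (le_neg_of_le_neg hc)).eigenspace_eq_bot hAV

theorem neg_le_of_isEigenbasis {φ : HilbertBasis ℕ ℂ (TorusL2 a b)} {e : ℕ → ℝ}
    (hφ : IsEigenbasis (fiberHamiltonian a b A V k) φ e) (n : ℕ) : -l₀ ≤ e n := by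
  by_contra! hlt
  have hmem := mem_eigenspace.2 (hφ n)
  rw [eigenspace_eq_bot_of_le hAV h hlt.le, Submodule.mem_bot] at hmem
  exact φ.orthonormal.ne_zero n hmem

theorem exists_isEigenbasis_of_isFreeParametrix :
    ∃ (φ : HilbertBasis ℕ ℂ (TorusL2 a b)) (e : ℕ → ℝ),
      IsEigenbasis (fiberHamiltonian a b A V k) φ e ∧ Monotone e ∧ Tendsto e atTop atTop := by
  obtain ⟨R, hR, hcompact⟩ := (h l₀ le_rfl).exists_isResolventAt hAV
  exact hR.exists_isEigenbasis (not_finiteDimensional_torusL2 hab)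
    (isSymmetric_fiberHamiltonian hab k) hcompact fun c hc => eigenspace_eq_bot_of_le hAV h hc

end

section

include hab

theorem exists_isEigenbasis_of_isEigenvalueList (hAV : WeakAssumption a b A V) {k : Plane}
    {e : ℕ → ℝ} (he : IsEigenvalueList (fiberHamiltonian a b A V k) e) :
    ∃ φ, IsEigenbasis (fiberHamiltonian a b A V k) φ e ∧ Tendsto e atTop atTop := by
  obtain ⟨l₀, h⟩ := eventually_atTop.1 (eventually_isFreeParametrix hab hAV k)
  obtain ⟨φ, e', hφ, hm, ht⟩ := exists_isEigenbasis_of_isFreeParametrix hAV h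
  obtain rfl := hφ.eq_of_isEigenvalueList (isSymmetric_fiberHamiltonian hab k) hm ht he
  exact ⟨φ, hφ, ht⟩

theorem isEigenvalueList_unique (hAV : WeakAssumption a b A V) {k : Plane} {e e' : ℕ → ℝ}
    (he : IsEigenvalueList (fiberHamiltonian a b A V k) e)
    (he' : IsEigenvalueList (fiberHamiltonian a b A V k) e') : e = e' := by
  obtain ⟨φ, hφ, ht⟩ := exists_isEigenbasis_of_isEigenvalueList hab hAV he
  exact (hφ.eq_of_isEigenvalueList (isSymmetric_fiberHamiltonian hab k) he.1 ht he').symm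

end

end Spectrum

/-! ### Continuity in the quasimomentum -/

section Continuity

variable {a b : Plane} {A : Plane → Plane} {V : Plane → ℝ} (hab : LinearIndependent ℝ ![a, b])
  (hAV : WeakAssumption a b A V)

theorem mulShift_add (k g : Plane) (j : Fin 2) (u : TorusL2 a b) :
    mulShift hAV (k + g) j u = mulShift hAV k j u + (g j : ℂ) • u := by
  rw [← mulContinuous_const]
  refine (mulContinuous_add _ _ _ (fun x => ?_) u).symm
  simp only [shiftedPotential, PiLp.add_apply]
  push_cast
  ring

include hab hAV in
theorem mem_graph_kineticMomentum_add {k : Plane} (g : Plane) {j : Fin 2} {u p : TorusL2 a b}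
    (h : (u, p) ∈ (kineticMomentum a b A k j).graph) :
    (u, p + (g j : ℂ) • u) ∈ (kineticMomentum a b A (k + g) j).graph := by
  obtain ⟨d, hd, rfl⟩ := (mem_graph_kineticMomentum hab hAV).1 h
  exact (mem_graph_kineticMomentum hab hAV).2 ⟨d, hd, by rw [mulShift_add, add_assoc]⟩

/-- The operator `(-i ∂_j + k_j - A_j) (-Δ / 2 + l)⁻¹`. -/
noncomputable def momentumFreeResolvent (k : Plane) (l : ℝ) (j : Fin 2) :
    TorusL2 a b →L[ℂ] TorusL2 a b :=
  (-Complex.I) • derivFreeResolvent hab l j + mulShift hAV k j ∘L freeResolvent hab l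

theorem mem_graph_momentumFreeResolvent (k : Plane) {l : ℝ} (hl : 0 < l) (j : Fin 2)
    (f : TorusL2 a b) : (freeResolvent hab l f, momentumFreeResolvent hab hAV k l j f) ∈
      (kineticMomentum a b A k j).graph :=
  (mem_graph_kineticMomentum hab hAV).2 ⟨_, isWeakDeriv_freeResolvent hab hl j f, rfl⟩

/-- The operator `(H(k + g) - H(k)) (-Δ / 2 + l)⁻¹`, by expanding the square
`(-i ∂_j + k_j + g_j - A_j)²`. -/
noncomputable def shiftPerturbation (k : Plane) (l : ℝ) (g : Plane) :
    TorusL2 a b →L[ℂ] TorusL2 a b :=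
  (g 0 : ℂ) • momentumFreeResolvent hab hAV k l 0 +
    (g 1 : ℂ) • momentumFreeResolvent hab hAV k l 1 +
    (((g 0 : ℂ) ^ 2 + (g 1 : ℂ) ^ 2) / 2) • freeResolvent hab l

theorem continuous_shiftPerturbation (k : Plane) (l : ℝ) :
    Continuous (shiftPerturbation hab hAV k l) := by
  unfold shiftPerturbation
  fun_prop

theorem shiftPerturbation_zero (k : Plane) (l : ℝ) : shiftPerturbation hab hAV k l 0 = 0 := by
  simp [shiftPerturbation]

theorem mem_graph_fiberHamiltonian_add {k : Plane} {l : ℝ} (hl : 0 < l) (g : Plane)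
    {f y : TorusL2 a b} (h : (freeResolvent hab l f, y) ∈ (fiberHamiltonian a b A V k).graph) :
    (freeResolvent hab l f, y + shiftPerturbation hab hAV k l g f) ∈
      (fiberHamiltonian a b A V (k + g)).graph := by
  obtain ⟨p, q, v, hpq, hv, rfl⟩ := mem_graph_fiberHamiltonian.1 h
  have hp (j : Fin 2) : momentumFreeResolvent hab hAV k l j f = p j :=
    (kineticMomentum a b A k j).mem_graph_snd_inj
      (mem_graph_momentumFreeResolvent hab hAV k hl j f) (hpq j).1 rfl
  refine mem_graph_fiberHamiltonian.2 ⟨fun j => p j + (g j : ℂ) • freeResolvent hab l f,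
    fun j => (q j + (g j : ℂ) • p j) + (g j : ℂ) • (p j + (g j : ℂ) • freeResolvent hab l f), v,
    fun j => ⟨mem_graph_kineticMomentum_add hab hAV g (hpq j).1, Submodule.add_mem _
      (mem_graph_kineticMomentum_add hab hAV g (hpq j).2)
      (Submodule.smul_mem _ (g j : ℂ) (mem_graph_kineticMomentum_add hab hAV g (hpq j).1))⟩,
    hv, ?_⟩
  simp only [shiftPerturbation, add_apply, smul_apply, hp]
  module

variable {hab} in
theorem IsFreeParametrix.isRelativePerturbation {k : Plane} {l : ℝ}
    (h : IsFreeParametrix hab A V k l) (g : Plane) :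
    IsRelativePerturbation (fiberHamiltonian a b A V k) (fiberHamiltonian a b A V (k + g)) l
      (2 * ‖shiftPerturbation hab hAV k l g‖) where
  domain_eq := SetLike.coe_injective <| by
    rw [domain_fiberHamiltonian hab hAV, domain_fiberHamiltonian hab hAV]
  norm_sub_le {u y y'} hy hy' := by
    obtain ⟨f, rfl, hf⟩ := h.exists_norm_le hAV hy
    obtain rfl := (fiberHamiltonian a b A V (k + g)).mem_graph_snd_inj hy'
      (mem_graph_fiberHamiltonian_add hab hAV h.1 g hy) rfl
    rw [add_sub_cancel_left, mul_comm 2, mul_assoc]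
    exact (shiftPerturbation hab hAV k l g).le_opNorm_of_le hf

include hab hAV in
theorem continuous_eigenvalue {E : ℕ → Plane → ℝ}
    (hE : ∀ k, IsEigenvalueList (fiberHamiltonian a b A V k) fun n => E n k) (n : ℕ) :
    Continuous (E n) := by
  refine continuous_iff_continuousAt.2 fun k => ?_
  obtain ⟨l, h⟩ := eventually_atTop.1 (eventually_isFreeParametrix hab hAV k)
  obtain ⟨φ, hφ, -⟩ := exists_isEigenbasis_of_isEigenvalueList hab hAV (hE k)
  let δ (k' : Plane) : ℝ := 2 * ‖shiftPerturbation hab hAV k l (k' - k)‖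
  have hδ : Tendsto δ (𝓝 k) (𝓝 0) := by
    have hcont : Continuous δ := by
      have := continuous_shiftPerturbation hab hAV k l
      fun_prop
    refine hcont.tendsto' k 0 ?_
    simp only [δ, sub_self, shiftPerturbation_zero, norm_zero, mul_zero]
  have hbound : ∀ᶠ k' in 𝓝 k, |E n k' - E n k| ≤ δ k' * (E n k + l) := by
    filter_upwards [hδ.eventually_lt_const one_pos] with k' hk'
    obtain ⟨φ', hφ', -⟩ := exists_isEigenbasis_of_isEigenvalueList hab hAV (hE k')
    have hrel := (h l le_rfl).isRelativePerturbation hAV (k' - k)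
    rw [add_sub_cancel] at hrel
    exact hrel.abs_sub_le (by positivity) hk' hφ hφ' (isSymmetric_fiberHamiltonian hab k)
      (isSymmetric_fiberHamiltonian hab k') (hE k).1 (hE k').1
      (fun m => by linarith [neg_le_of_isEigenbasis hAV h hφ m]) n
  refine tendsto_iff_norm_sub_tendsto_zero.2 (squeeze_zero' (.of_forall fun _ => norm_nonneg _)
    hbound ?_)
  simpa only [zero_mul] using hδ.mul_const (E n k + l)

end Continuity

/-! ### Periodicity in the quasimomentum -/

section Periodicity

variable {a b : Plane} {A : Plane → Plane} {V : Plane → ℝ}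

/-- Multiplication by the plane wave `exp (i g · x)`. -/
noncomputable def mulPlaneWave (a b : Plane) (g : Plane) : TorusL2 a b →L[ℂ] TorusL2 a b :=
  mulContinuous a b (contDiff_planeWave (n := 1) g).continuous

theorem injective_mulPlaneWave (g : Plane) : Function.Injective (mulPlaneWave a b g) := by
  refine Function.LeftInverse.injective (g := mulPlaneWave a b (-g)) fun u => ?_
  refine (mulContinuous_mulContinuous _ _ (continuous_const (y := (1 : ℂ))) (fun x => ?_) u).trans
    ((mulContinuous_const 1 u).trans (one_smul ℂ u))
  rw [planeWave, planeWave, ← Complex.exp_add, inner_neg_left]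
  simp

theorem mulContinuous_pderiv_planeWave (g : Plane) (j : Fin 2) (u : TorusL2 a b) :
    mulContinuous a b (continuous_pderiv (contDiff_planeWave g) j) u =
      (Complex.I * g j) • mulPlaneWave a b g u := by
  rw [← mulContinuous_const]
  exact (mulContinuous_mulContinuous _ _ _ (fun x => (pderiv_planeWave j g x).symm) u).symm

section

variable (hab : LinearIndependent ℝ ![a, b]) (hAV : WeakAssumption a b A V)
include hab hAV

/-- Conjugation by the plane wave `exp (-i g · x)` turns `-i ∂_j` into `-i ∂_j + g_j`. -/
theorem mem_graph_kineticMomentum_mulPlaneWave {k g : Plane} (hg : g ∈ dualLattice a b)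
    {j : Fin 2} {u p : TorusL2 a b} (h : (u, p) ∈ (kineticMomentum a b A k j).graph) :
    (mulPlaneWave a b (-g) u, mulPlaneWave a b (-g) p) ∈
      (kineticMomentum a b A (k + g) j).graph := by
  obtain ⟨d, hd, rfl⟩ := (mem_graph_kineticMomentum hab hAV).1 h
  refine (mem_graph_kineticMomentum hab hAV).2 ⟨_, hd.mulContinuous hab (contDiff_planeWave (-g))
    (isTorusSmooth_planeWave (neg_mem_dualLattice hg)).2, ?_⟩
  have hcomm : mulPlaneWave a b (-g) (mulShift hAV k j u) =
    mulShift hAV k j (mulPlaneWave a b (-g) u) := mulContinuous_comm _ _ u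
  rw [mulContinuous_pderiv_planeWave, ← mulPlaneWave, mulShift_add, map_add, map_smul, hcomm,
    PiLp.neg_apply]
  match_scalars
  · ring
  · linear_combination (g j : ℂ) * Complex.I_sq
  · ring

theorem mem_graph_fiberHamiltonian_mulPlaneWave {k g : Plane} (hg : g ∈ dualLattice a b)
    {u y : TorusL2 a b} (h : (u, y) ∈ (fiberHamiltonian a b A V k).graph) :
    (mulPlaneWave a b (-g) u, mulPlaneWave a b (-g) y) ∈
      (fiberHamiltonian a b A V (k + g)).graph := by
  obtain ⟨p, q, v, hpq, hv, rfl⟩ := mem_graph_fiberHamiltonian.1 h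
  refine mem_graph_fiberHamiltonian.2 ⟨fun j => mulPlaneWave a b (-g) (p j),
    fun j => mulPlaneWave a b (-g) (q j), mulPlaneWave a b (-g) v,
    fun j => ⟨mem_graph_kineticMomentum_mulPlaneWave hab hAV hg (hpq j).1,
      mem_graph_kineticMomentum_mulPlaneWave hab hAV hg (hpq j).2⟩, ?_,
    by simp only [map_add, map_smul]⟩
  have hcoe := coeFn_mulContinuous (a := a) (b := b) (contDiff_planeWave (n := 1) (-g)).continuous
  filter_upwards [hv, hcoe v, hcoe u] with x hvx hPv hPu
  simp only [mulPlaneWave, hPv, hPu, hvx, mul_left_comm]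

theorem rank_eigenspace_le (k : Plane) {g : Plane} (hg : g ∈ dualLattice a b) (z : ℂ) :
    Module.rank ℂ (eigenspace (fiberHamiltonian a b A V k) z) ≤
      Module.rank ℂ (eigenspace (fiberHamiltonian a b A V (k + g)) z) := by
  have hmap : ∀ u ∈ eigenspace (fiberHamiltonian a b A V k) z,
      (mulPlaneWave a b (-g) : TorusL2 a b →ₗ[ℂ] TorusL2 a b) u ∈
        eigenspace (fiberHamiltonian a b A V (k + g)) z := fun u hu => by
    have := mem_graph_fiberHamiltonian_mulPlaneWave hab hAV hg (mem_eigenspace.1 hu)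
    rwa [map_smul] at this
  exact LinearMap.rank_le_of_injective (LinearMap.restrict _ hmap) fun u v huv =>
    Subtype.ext (injective_mulPlaneWave (-g) (congrArg Subtype.val huv))

theorem eigenvalue_add_eq {E : ℕ → Plane → ℝ}
    (hE : ∀ k, IsEigenvalueList (fiberHamiltonian a b A V k) fun n => E n k) (n : ℕ) {g : Plane}
    (hg : g ∈ dualLattice a b) (k : Plane) : E n (k + g) = E n k := by
  have hrank (z : ℂ) : Module.rank ℂ (eigenspace (fiberHamiltonian a b A V k) z) =
      Module.rank ℂ (eigenspace (fiberHamiltonian a b A V (k + g)) z) := by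
    refine (rank_eigenspace_le hab hAV k hg z).antisymm ?_
    have hback := rank_eigenspace_le hab hAV (k + g) (neg_mem_dualLattice hg) z
    rwa [add_neg_cancel_right] at hback
  have hE' : IsEigenvalueList (fiberHamiltonian a b A V k) fun n => E n (k + g) :=
    ⟨(hE (k + g)).1, fun l => by rw [hrank]; exact (hE (k + g)).2 l⟩
  exact congrFun (isEigenvalueList_unique hab hAV hE' (hE k)) n

end

end Periodicity

end BlochFiber

theorem proposition3p1 (a b : BlochFiber.Plane) (hab : LinearIndependent ℝ ![a, b])
    (A : BlochFiber.Plane → BlochFiber.Plane) (V : BlochFiber.Plane → ℝ)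
    (hAV : BlochFiber.WeakAssumption a b A V) :
    (∀ k : BlochFiber.Plane,
      ((BlochFiber.fiberHamiltonian a b A V k).domain : Set (BlochFiber.TorusL2 a b)) =
          BlochFiber.sobolevTwo a b ∧
        IsSelfAdjoint (BlochFiber.fiberHamiltonian a b A V k) ∧
        UnboundedOperator.IsBoundedBelow (BlochFiber.fiberHamiltonian a b A V k)) ∧
    (∀ k : BlochFiber.Plane,
      UnboundedOperator.HasCompactResolvent (BlochFiber.fiberHamiltonian a b A V k) ∧
        UnboundedOperator.HasPurelyDiscreteSpectrum (BlochFiber.fiberHamiltonian a b A V k) ∧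
        (∃ e : ℕ → ℝ,
          UnboundedOperator.IsEigenvalueList (BlochFiber.fiberHamiltonian a b A V k) e) ∧
        ∀ e : ℕ → ℝ,
          UnboundedOperator.IsEigenvalueList (BlochFiber.fiberHamiltonian a b A V k) e →
            Filter.Tendsto e Filter.atTop Filter.atTop) ∧
    (∀ E : ℕ → BlochFiber.Plane → ℝ,
      (∀ k : BlochFiber.Plane, UnboundedOperator.IsEigenvalueList
        (BlochFiber.fiberHamiltonian a b A V k) fun n => E n k) →
      ∀ n : ℕ, Continuous (E n) ∧
        ∀ g ∈ BlochFiber.dualLattice a b, ∀ k : BlochFiber.Plane, E n (k + g) = E n k) := by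
  refine ⟨fun k => ?_, fun k => ?_, fun E hE n => ⟨BlochFiber.continuous_eigenvalue hab hAV hE n,
    fun g hg k => BlochFiber.eigenvalue_add_eq hab hAV hE n hg k⟩⟩
  all_goals
    have hsymm := BlochFiber.isSymmetric_fiberHamiltonian (A := A) (V := V) hab k
    obtain ⟨l, hl⟩ := Filter.eventually_atTop.1
      (BlochFiber.eventually_isFreeParametrix hab hAV k)
    obtain ⟨R, hR, hcompact⟩ := (hl l le_rfl).exists_isResolventAt hAV
    obtain ⟨φ, e, hφ, hmono, hlim⟩ := BlochFiber.exists_isEigenbasis_of_isFreeParametrix hAV hl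
  · exact ⟨BlochFiber.domain_fiberHamiltonian hab hAV k, hR.isSelfAdjoint hsymm,
      hφ.isBoundedBelow hsymm (BlochFiber.neg_le_of_isEigenbasis hAV hl hφ)⟩
  · refine ⟨hR.hasCompactResolvent hcompact, ?_, ⟨e, hφ.isEigenvalueList hsymm hmono hlim⟩,
      fun e' he' => ?_⟩
    · rw [← Nat.cofinite_eq_atTop] at hlim
      exact hφ.hasPurelyDiscreteSpectrum hsymm hlim fun z => hR.eigenspace_ne_bot hcompact
    · obtain ⟨-, -, hlim'⟩ := BlochFiber.exists_isEigenbasis_of_isEigenvalueList hab hAV he'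
      exact hlim'
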